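/- Let $S$ be a germ of irreducible curve at the origin of $\mathbb{C}^2$, and let $E=E_1\circ\cdots\circ E_N$ be its minimal desingularization, i.e. the shortest sequence of blowing-ups of points, centred at the successive infinitely near points $c_1=0,c_2,\dots,c_N$ of $S$, after which the total transform of $S$ has only normal crossings. Let $S_1=S$ and, for $i\ge2$, let $S_i$ be the strict transform of $S$ by $E_1\circ\cdots\circ E_{i-1}$, a germ at $c_i$, and let $\nu(S_i)$ be its algebraic multiplicity. Let $D=E^{-1}(0)=D_1\cup\cdots\cup D_N$, where $D_i$ is the component created by the blowing-up of $c_i$ (the same symbol denotes its strict transforms). The proximity matrix $\mathcal{E}$ is the $N\times N$ matrix with $\mathcal{E}_{ii}=1$, with $\mathcal{E}_{ji}=-1$ if $j<i$ and $c_i\in D_j$ (that is, if $j=i-1$, or if $c_i$ is the point $D_{i-1}\cap D_j$), and with all other entries $0$. Let $n_i-1$ be the number of entries $-1$ on its $i$-th row. If a branch $C$ is singular, then in suitable local holomorphic coordinates and for a suitable parameter it is parametrized by $x=t^p$, $y=t^q+\sum_{k>q}a_kt^k$ with $p<q$, $p\nmid q$; the integers $p=p(C)=\nu(C)$ and $q=q(C)$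 depend only on $C$. Let $d$ be a direction, i.e. the empty set, a smooth germ of curve at $0$, or the union of two transverse smooth germs at $0$; $d^E$ is its strict transform by $E$. Let $\delta_1\in\{0,1,2\}$ be the number of components of $d$ and, for $2\le i\le N$, let $\delta_i$ be the number of branches of the total transform of $d$ by $E_1\circ\cdots\circ E_{i-1}$ (components of the exceptional divisor, and strict transforms of components of $d$) passing through $c_i$. Define integers $p_1,\dots,p_N$ by $$\begin{pmatrix}p_1\\ \vdots\\ p_N\end{pmatrix}=\mathcal{E}\begin{pmatrix}\left[\frac{\nu(S_1)-\delta_1}{2}\right]+1\\ \vdots\\ \left[\frac{\nu(S_N)-\delta_N}{2}\right]+1\end{pmatrix},$$ where $[x]$ is the largest integer $\le x$. Then $\delta_i\in\{1,2\}$ for $2\le i\le N$, and: 1. $p_i\ge-1$ for every $i$, and $p_i=-1$ if and only if one of the following holds: (a) $n_i=2$, $\delta_i=2$, $\delta_{i+1}=1$ and $\nu(S_i)$ is odd; (b) $n_i=3$, $\delta_i=2$, $\delta_{i+1}=1$, $\nu(S_i)$ is odd and $q(S_i)$ is even (when $n_i=3$, the germ $S_i$ is singular, so $q(S_i)$ is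 defined). 2. If $i\ne j$ and $D_i\cap D_j\ne\emptyset$ in $D$, then $p_i$ and $p_j$ are not both equal to $-1$. 3. Let $\overline{D}$ be $D$ deprived of $D_N$ and of the components $D_i$ with $p_i=-1$. Each connected component of $\overline{D}$ contains a component $D_j$ such that $p_j>0$ or $D_j$ meets a component of $d^E$. -/

import Mathlib

open Filter Topology

noncomputable section

namespace PlaneBranch

/-! Germs of curves in `(ℂ², 0)` are given by holomorphic parametrizations `(ℂ, 0) → (ℂ², 0)`;
only the germ at `0` of such a map matters. -/

/-- A germ of irreducible curve (a branch) `{γ t}`, given by a holomorphic parametrization that is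
injective near `0`. -/
def IsBranch (γ : ℂ → ℂ × ℂ) : Prop :=
  AnalyticAt ℂ γ 0 ∧ γ 0 = 0 ∧ ∃ U ∈ 𝓝 (0 : ℂ), Set.InjOn γ U

/-- A smooth germ of curve, given by an immersive holomorphic parametrization. -/
def IsSmoothGerm (γ : ℂ → ℂ × ℂ) : Prop :=
  AnalyticAt ℂ γ 0 ∧ γ 0 = 0 ∧ deriv γ 0 ≠ 0

/-- Two (smooth) germs are transverse: their tangent lines at the origin differ. -/
def Transverse (γ σ : ℂ → ℂ × ℂ) : Prop :=
  LinearIndependent ℂ ![deriv γ 0, deriv σ 0]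

/-- The algebraic multiplicity `ν` of the branch parametrized by `γ`. -/
def mult (γ : ℂ → ℂ × ℂ) : ℕ :=
  (min (analyticOrderAt (fun t => (γ t).1) 0) (analyticOrderAt (fun t => (γ t).2) 0)).toNat

/-- In suitable local holomorphic coordinates (`Φ`) and for a suitable holomorphic parameter (`τ`),
the branch has a Puiseux parametrization `x = t ^ p`, `y = t ^ q + ∑_{k > q} a_k t ^ k` with
`p < q` and `p ∤ q`. -/
def HasPuiseuxPair (γ : ℂ → ℂ × ℂ) (p q : ℕ) : Prop :=
  p < q ∧ ¬ p ∣ q ∧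
    ∃ (Φ : ℂ × ℂ → ℂ × ℂ) (τ h : ℂ → ℂ),
      (AnalyticAt ℂ Φ 0 ∧ Φ 0 = 0 ∧ Function.Bijective (fderiv ℂ Φ 0)) ∧
      (AnalyticAt ℂ τ 0 ∧ τ 0 = 0 ∧ deriv τ 0 ≠ 0) ∧
      AnalyticAt ℂ h 0 ∧
      ∀ᶠ t in 𝓝 (0 : ℂ), Φ (γ (τ t)) = (t ^ p, t ^ q + t ^ (q + 1) * h t)

/-! ### Blowing up

The exceptional line of the blowing-up of the origin of `ℂ²` is the projective line
`OnePoint ℂ` of directions: `c : ℂ` is the line `y = c x`, and `∞` is the line `x = 0`. -/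

/-- The blowing-up of the origin, read in the standard chart centred at the point `s` of the
exceptional line: `(u, v) ↦ (u, u (v + c))` for `s = c`, and `(u, v) ↦ (u v, v)` for `s = ∞`. -/
def blowChart (s : OnePoint ℂ) (z : ℂ × ℂ) : ℂ × ℂ :=
  s.elim (z.1 * z.2, z.2) (fun c => (z.1, z.1 * (z.2 + c)))

/-- The exceptional line in the chart `blowChart s`: `u = 0` for `s = c`, and `v = 0` for
`s = ∞`. -/
def excCurve (s : OnePoint ℂ) (t : ℂ) : ℂ × ℂ :=
  s.elim (t, 0) (fun _ => (0, t))

/-- `σ'` is a germ of curve at the origin of the chart `Φ` lifting `σ`. For `Φ` a composite of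
blowing-ups and `σ` a germ of curve, such a `σ'` exists if and only if the strict transform of `σ`
passes through the origin of the chart, and it is then this strict transform. -/
def IsLift (Φ : ℂ × ℂ → ℂ × ℂ) (σ σ' : ℂ → ℂ × ℂ) : Prop :=
  AnalyticAt ℂ σ' 0 ∧ σ' 0 = 0 ∧ ∀ᶠ t in 𝓝 (0 : ℂ), σ t = Φ (σ' t)

/-- The infinitely near points of the branch `S`. The centres are `c 0, c 1, …`, where `c 0` is the
origin of `ℂ²`, and `c (i + 1)` is the point `s i` of the exceptional line of the blowing-up of
`c i`; `T i` is the strict transform of `S` at `c i`, in the chart centred there. The centre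
`c (i + 1)` is the one point of this exceptional line which the strict transform of `S` meets. -/
def IsBlowupSequence (S : ℂ → ℂ × ℂ) (s : ℕ → OnePoint ℂ) (T : ℕ → ℂ → ℂ × ℂ) : Prop :=
  T 0 = S ∧ ∀ i, IsLift (blowChart (s i)) (T i) (T (i + 1))

/-- The composite of the blowing-ups of `c j, …, c (j + k - 1)`, from the chart centred at
`c (j + k)` to the chart centred at `c j`. -/
def composite (s : ℕ → OnePoint ℂ) (j : ℕ) : ℕ → ℂ × ℂ → ℂ × ℂ
  | 0 => id
  | k + 1 => composite s j k ∘ blowChart (s (j + k))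

/-- `σ` is the strict transform at `c i` of the exceptional component `D j` created by the
blowing-up of `c j`. -/
def IsExcAt (s : ℕ → OnePoint ℂ) (j i : ℕ) (σ : ℂ → ℂ × ℂ) : Prop :=
  j < i ∧ IsLift (composite s (j + 1) (i - (j + 1))) (excCurve (s j)) σ

/-- The (strict transform of the) component `D j` passes through the centre `c i`. -/
def ExcThrough (s : ℕ → OnePoint ℂ) (j i : ℕ) : Prop :=
  ∃ σ, IsExcAt s j i σ

/-- The total transform of `S` after the blowing-ups of `c 0, …, c (n - 1)` has normal crossings at
`c n` (hence everywhere, as `c n` is the one point where the strict transform of `S` meets the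
exceptional divisor): the branches passing through `c n`, namely the strict transform of `S` and
exceptional components, are smooth, pairwise transverse, and at most two. -/
def IsNormalCrossing (s : ℕ → OnePoint ℂ) (T : ℕ → ℂ → ℂ × ℂ) (n : ℕ) : Prop :=
  IsSmoothGerm (T n) ∧ {j | ExcThrough s j n}.ncard ≤ 1 ∧
    ∀ j σ, IsExcAt s j n σ → Transverse (T n) σ

/-- The blowing-ups of `c 0, …, c (N - 1)` form the minimal desingularization of `S`. -/
def IsMinimalDesingularization (s : ℕ → OnePoint ℂ) (T : ℕ → ℂ → ℂ × ℂ) (N : ℕ) : Prop :=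
  IsLeast {n | IsNormalCrossing s T n} N

/-! ### The exceptional divisor of the desingularization -/

/-- The points of the exceptional divisor `D` after the blowing-ups of `c 0, …, c (N - 1)`: the
pair `(m, l)` is the point `l` of the exceptional line of the blowing-up of `c m`, and it is a point
of `D` unless it is blown up at the next step, i.e. unless it is the centre `c (m + 1)`. -/
def divisorPoints (s : ℕ → OnePoint ℂ) (N : ℕ) : Set (ℕ × OnePoint ℂ) :=
  {P | P.1 < N ∧ (P.1 + 1 < N → P.2 ≠ s P.1)}

/-- The points of `D` lying on the strict transform of a germ of curve `σ` at `c j` (in the chart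
centred there) and created by the blowing-ups of `c j, …, c (N - 1)`. -/
def strictPoints (s : ℕ → OnePoint ℂ) (N j : ℕ) (σ : ℂ → ℂ × ℂ) : Set (ℕ × OnePoint ℂ) :=
  {P | P ∈ divisorPoints s N ∧ j ≤ P.1 ∧
    ∃ σ', IsLift (composite s j (P.1 - j) ∘ blowChart P.2) σ σ'}

/-- The component `D i` of `D`: what remains of the exceptional line of the blowing-up of `c i`,
and the points of its strict transform created by the later blowing-ups. -/
def component (s : ℕ → OnePoint ℂ) (N i : ℕ) : Set (ℕ × OnePoint ℂ) :=
  {P | P ∈ divisorPoints s N ∧ P.1 = i} ∪ strictPoints s N (i + 1) (excCurve (s i))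

/-- The dual graph of `D`: an edge joins two components that intersect. -/
def dualGraph (s : ℕ → OnePoint ℂ) (N : ℕ) : SimpleGraph (Fin N) where
  Adj i j := i ≠ j ∧ (component s N i ∩ component s N j).Nonempty
  symm := ⟨fun _ _ h => ⟨h.1.symm, by rw [Set.inter_comm]; exact h.2⟩⟩
  loopless := ⟨fun _ h => h.1 rfl⟩

/-! ### The proximity matrix and the integers `p_i` -/

/-- The proximity matrix. Its entry at `(j, i)` is `1` if `j = i`, it is `-1` if `c i` lies on an
earlier component `D j` (that is, `j = i - 1`, or `c i` is the point `D (i - 1) ∩ D j`), and it is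
`0` otherwise. -/
def proximityMatrix (s : ℕ → OnePoint ℂ) (N : ℕ) : Matrix (Fin N) (Fin N) ℤ :=
  open Classical in
  Matrix.of fun j i => if j = i then 1 else if ExcThrough s j i then -1 else 0

/-- `n_i`, where `n_i - 1` is the number of entries `-1` on row `i` of the proximity matrix. -/
def rowNumber (s : ℕ → OnePoint ℂ) (N : ℕ) (i : Fin N) : ℕ :=
  {k | proximityMatrix s N i k = -1}.ncard + 1

/-- `δ_i`: the number of branches through `c i` of the total transform, by the blowing-ups of
`c 0, …, c (i - 1)`, of the direction with components `d k`. For `i = 0` it is the number of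
components of the direction. -/
def branchCount (s : ℕ → OnePoint ℂ) {r : ℕ} (d : Fin r → ℂ → ℂ × ℂ) (i : ℕ) : ℕ :=
  {j | ExcThrough s j i}.ncard + {k | ∃ σ, IsLift (composite s 0 i) (d k) σ}.ncard

/-- The vector `(p_i)`: the proximity matrix applied to `([(ν(S_i) - δ_i) / 2] + 1)_i`. The
division of integers by `2` rounds down. -/
def pVector (s : ℕ → OnePoint ℂ) (T : ℕ → ℂ → ℂ × ℂ) {r : ℕ} (d : Fin r → ℂ → ℂ × ℂ) (N : ℕ) :
    Fin N → ℤ :=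
  (proximityMatrix s N).mulVec fun i => ((mult (T i) : ℤ) - (branchCount s d i : ℤ)) / 2 + 1

end PlaneBranch

end

open PlaneBranch

/-! In the standard charts an exceptional component through a centre is always a coordinate axis,
and blowing up keeps axes axes (`isLift_composite_excCurve_iff`). Incidence is thus read off the
sequence `s`: for `i < n`, where `c n` is the last centre, the centres on `D i` are the `c k` with
`i < k ≤ lastCentre s i`, and a centre lies on at most one component besides the newest.

Write `ν_i`, `δ_i` for `mult (T i)`, `branchCount s d i`, and let `e_i = 2([(ν_i - δ_i)/2] + 1) -
ν_i` (`defect`). By the proximity equality `ν_i = ∑ ν_k` over the centres on `D i`, the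
multiplicities cancel in `p_i`, leaving `2 p_i = e_i - e_{i+1} - ∑ e_k`, with `k` running over `i +
2, …, lastCentre s i` (`two_mul_pVector`). Now `e_i ≥ -1`, with equality exactly when `δ_i = 2` and
`ν_i` is odd; `e_{i+1} ≤ 1`; and the `e_k` of the sum are `≤ 0`, since those centres are crossings
and have `δ_k = 2`. Hence `p_i ≥ -1`, and equality makes every term extremal. The proximity equality
and `q(S_i) = ν_i + ν_{i+1}` (`hasPuiseuxPair_iff`) turn this into (a) and (b). The last centre on
`D i` then has defect `0` or `1`, so its component does not have `p = -1`: this is assertion 2.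

For assertion 3 (`false_of_component`), suppose a connected component has only `p = 0` and is not
met by the direction. Its least index has `e ≥ 0`; let `a` be its greatest index with `e_a ≥ 0`. The
last centre on `D a` has defect `-1`, so `p_a = 0` forces `e_a = 0` and `e_{a+1} = 1`: `ν_a` is
even, and `c (a + 1)` lies on `D a` only and not on the direction. Membership and even multiplicity
then descend from `a` to `0`. A branch of the direction would be carried along to `c (a + 1)`, so
the direction is empty; then `e_0 = 2` and `p_0 > 0`, a contradiction. -/

namespace PlaneBranch

/-! ### Puiseux pairs -/

theorem exists_analytic_localInverse {Φ : ℂ × ℂ → ℂ × ℂ} (h : AnalyticAt ℂ Φ 0) (h0 : Φ 0 = 0)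
    (hb : Function.Bijective (fderiv ℂ Φ 0)) :
    ∃ Ψ : ℂ × ℂ → ℂ × ℂ, AnalyticAt ℂ Ψ 0 ∧ ∀ᶠ z in 𝓝 0, Ψ (Φ z) = z := by
  let i : (ℂ × ℂ) ≃L[ℂ] (ℂ × ℂ) := ContinuousLinearEquiv.ofBijective (fderiv ℂ Φ 0)
    (LinearMap.ker_eq_bot.2 hb.1) (LinearMap.range_eq_top.2 hb.2)
  have hi : fderiv ℂ Φ 0 = i := by ext <;> rfl
  have hs : HasStrictFDerivAt Φ (i : (ℂ × ℂ) →L[ℂ] (ℂ × ℂ)) 0 := hi ▸ h.hasStrictFDerivAt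
  refine ⟨hs.localInverse Φ i 0, ?_, hs.eventually_left_inverse⟩
  have := (hs.toOpenPartialHomeomorph Φ).analyticAt_symm' (i := i)
    hs.mem_toOpenPartialHomeomorph_source h hi
  rwa [hs.toOpenPartialHomeomorph_coe, h0] at this

/-- Near `0` the function `f` is Lipschitz, so the difference is bounded by a constant times the
second coordinate; a smaller order would contradict this bound after division by a power of `t`. -/
theorem analyticOrderAt_sub_axis_le {f : ℂ × ℂ → ℂ} {γ : ℂ → ℂ × ℂ} (hf : AnalyticAt ℂ f 0)
    (hγ : AnalyticAt ℂ γ 0) (h0 : γ 0 = 0) :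
    analyticOrderAt (fun t => (γ t).2) 0 ≤
      analyticOrderAt (fun t => f (γ t) - f ((γ t).1, 0)) 0 := by
  have hx : AnalyticAt ℂ (fun t => (γ t).1) 0 := analyticAt_fst.fun_comp hγ
  have hw : AnalyticAt ℂ (fun t => (γ t).2) 0 := analyticAt_snd.fun_comp hγ
  have hax : AnalyticAt ℂ (fun t => ((γ t).1, (0 : ℂ))) 0 := hx.prod analyticAt_const
  have hax0 : ((γ 0).1, (0 : ℂ)) = 0 := by simp [h0]
  have hg : AnalyticAt ℂ (fun t => f (γ t) - f ((γ t).1, 0)) 0 := by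
    refine AnalyticAt.sub ?_ ?_
    · exact AnalyticAt.comp (g := f) (by rwa [h0]) hγ
    · exact AnalyticAt.comp (g := f) (by rwa [hax0]) hax
  obtain ⟨K, u, hu, hK⟩ := (hf.contDiffAt (n := 1)).exists_lipschitzOnWith
  have h1 : ∀ᶠ t in 𝓝 (0 : ℂ), γ t ∈ u := hγ.continuousAt (by rwa [h0])
  have h2 : ∀ᶠ t in 𝓝 (0 : ℂ), ((γ t).1, (0 : ℂ)) ∈ u := hax.continuousAt (by rwa [hax0])
  have hb : ∀ᶠ t in 𝓝 (0 : ℂ), ‖f (γ t) - f ((γ t).1, 0)‖ ≤ K * ‖(γ t).2‖ := by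
    filter_upwards [h1, h2] with t ht1 ht2
    have := hK.norm_sub_le ht1 ht2
    simpa [Prod.norm_def] using this
  by_contra! hlt
  obtain ⟨n, hn⟩ := ENat.ne_top_iff_exists.mp hlt.ne_top
  rw [← hn] at hlt
  obtain ⟨g, hga, hg0, hge⟩ := hg.analyticOrderAt_eq_natCast.1 hn.symm
  obtain ⟨w, hwa, hwe⟩ := (natCast_le_analyticOrderAt hw (n := n + 1)).1
    (by exact_mod_cast Order.add_one_le_of_lt hlt)
  have key : ∀ᶠ t in 𝓝[≠] (0 : ℂ), ‖g t‖ ≤ K * (‖t‖ * ‖w t‖) := by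
    filter_upwards [nhdsWithin_le_nhds hb, nhdsWithin_le_nhds hge, nhdsWithin_le_nhds hwe,
      self_mem_nhdsWithin] with t hb hge hwe ht
    rw [hge, hwe] at hb
    simp only [sub_zero, smul_eq_mul, norm_mul, norm_pow, pow_succ] at hb
    have hp : 0 < ‖t‖ ^ n := pow_pos (norm_pos_iff.2 ht) n
    refine le_of_mul_le_mul_left ?_ hp
    calc _ ≤ _ := hb
      _ = _ := by ring
  have hl : Tendsto (fun t => ‖g t‖) (𝓝[≠] (0 : ℂ)) (𝓝 ‖g 0‖) :=
    hga.continuousAt.norm.tendsto.mono_left nhdsWithin_le_nhds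
  have hr : Tendsto (fun t => K * (‖t‖ * ‖w t‖)) (𝓝[≠] (0 : ℂ)) (𝓝 (K * (‖(0 : ℂ)‖ * ‖w 0‖))) :=
    ((continuousAt_const.mul (continuousAt_id.norm.mul
      hwa.continuousAt.norm)).tendsto).mono_left nhdsWithin_le_nhds
  have := le_of_tendsto_of_tendsto hl hr key
  simp at this
  exact hg0 this

/-- An analytic function whose order along a branch is not a multiple of the order of the first
coordinate has at least the order of the second coordinate. -/
theorem analyticOrderAt_snd_le_of_not_dvd {f : ℂ × ℂ → ℂ} {γ : ℂ → ℂ × ℂ} {p n : ℕ}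
    (hf : AnalyticAt ℂ f 0) (hγ : AnalyticAt ℂ γ 0) (h0 : γ 0 = 0)
    (hp : analyticOrderAt (fun t => (γ t).1) 0 = p)
    (hn : analyticOrderAt (fun t => f (γ t)) 0 = n) (hpn : ¬ p ∣ n) :
    analyticOrderAt (fun t => (γ t).2) 0 ≤ n := by
  by_contra! hlt
  have hle := analyticOrderAt_sub_axis_le hf hγ h0
  have hx : AnalyticAt ℂ (fun t => (γ t).1) 0 := analyticAt_fst.fun_comp hγ
  have ha : AnalyticAt ℂ (fun x : ℂ => (x, (0 : ℂ))) 0 := by fun_prop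
  have hφ : AnalyticAt ℂ (fun x : ℂ => f (x, 0)) ((fun t => (γ t).1) 0) := by
    simp only [h0, Prod.fst_zero]
    exact AnalyticAt.comp (g := f) (x := (0 : ℂ)) hf ha
  have hc := hφ.analyticOrderAt_comp hx
  -- The restriction of `f` to the axis, composed with the first coordinate, has order a multiple of
  -- `p`; it would share the order `n` of `f` along the branch.
  have heq : ((fun x : ℂ => f (x, 0)) ∘ fun t => (γ t).1) =
      (fun t => f (γ t)) + -(fun t => f (γ t) - f ((γ t).1, 0)) := by
    ext t; simp
  rw [heq, analyticOrderAt_add_eq_left_of_lt, hn] at hc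
  · simp only [h0, Prod.fst_zero, sub_zero, hp] at hc
    cases h : analyticOrderAt (fun x : ℂ => f (x, 0)) 0 with
    | top =>
      rw [h] at hc
      rcases Nat.eq_zero_or_pos p with rfl | hp'
      · simp at hc; exact hpn (by simp [hc])
      · rw [ENat.top_mul (by exact_mod_cast hp'.ne')] at hc
        exact ENat.natCast_ne_top _ hc
    | coe m =>
      rw [h] at hc
      exact hpn ⟨m, by rw [mul_comm]; exact_mod_cast hc⟩
  · rw [analyticOrderAt_neg, hn]; exact hlt.trans_le hle

theorem analyticOrderAt_pow_mul_unit {h : ℂ → ℂ} {q : ℕ} (hh : AnalyticAt ℂ h 0) :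
    analyticOrderAt (fun t : ℂ => t ^ q + t ^ (q + 1) * h t) 0 = q := by
  rw [AnalyticAt.analyticOrderAt_eq_natCast (by fun_prop)]
  exact ⟨fun t => 1 + t * h t, by fun_prop, by simp, Eventually.of_forall fun t => by
    simp only [sub_zero, smul_eq_mul]; ring⟩

/-- In either coordinate system the order of the second coordinate is minimal among the orders of
analytic functions not divisible by `p`. Each exponent is realized in the other system, hence both
inequalities. -/
theorem HasPuiseuxPair.eq_of_order {γ : ℂ → ℂ × ℂ} {p q q' : ℕ} (L : (ℂ × ℂ) ≃L[ℂ] (ℂ × ℂ))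
    (hγ : AnalyticAt ℂ γ 0) (h0 : γ 0 = 0)
    (hp : analyticOrderAt (fun t => (L (γ t)).1) 0 = p)
    (hq : analyticOrderAt (fun t => (L (γ t)).2) 0 = q) (hpq : ¬ p ∣ q)
    (h : HasPuiseuxPair γ p q') : q' = q := by
  obtain ⟨-, hpq', Φ, τ, h, ⟨hΦ, hΦ0, hΦb⟩, ⟨hτ, hτ0, hτ'⟩, hh, he⟩ := h
  obtain ⟨Ψ, hΨ, hΨe⟩ := exists_analytic_localInverse hΦ hΦ0 hΦb
  have hγτ : AnalyticAt ℂ (fun t => γ (τ t)) 0 := AnalyticAt.comp (g := γ) (by rwa [hτ0]) hτ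
  have hγτ0 : γ (τ 0) = 0 := by rw [hτ0, h0]
  have h1 : analyticOrderAt (fun t => (L (γ (τ t))).1) 0 = p := by
    rw [← hp]
    simpa [hτ0] using! analyticOrderAt_comp_of_deriv_ne_zero (f := fun t => (L (γ t)).1) hτ hτ'
  have h2 : analyticOrderAt (fun t => (L (γ (τ t))).2) 0 = q := by
    rw [← hq]
    simpa [hτ0] using! analyticOrderAt_comp_of_deriv_ne_zero (f := fun t => (L (γ t)).2) hτ hτ'
  have hL : AnalyticAt ℂ (fun t => L (γ (τ t))) 0 :=
    (L.toContinuousLinearMap.analyticAt _).fun_comp hγτ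
  have hLs : AnalyticAt ℂ (fun z => L.symm z) 0 := L.symm.toContinuousLinearMap.analyticAt _
  set σ : ℂ → ℂ × ℂ := fun t => (t ^ p, t ^ q' + t ^ (q' + 1) * h t) with hσ
  have hσa : AnalyticAt ℂ σ 0 := by
    refine AnalyticAt.prod ?_ ?_ <;> fun_prop
  have hσ0 : σ 0 = 0 := by rw [show σ 0 = Φ (γ (τ 0)) from he.self_of_nhds.symm, hγτ0, hΦ0]
  have hσ1 : analyticOrderAt (fun t => (σ t).1) 0 = p := by
    have := analyticOrderAt_pow (𝕜 := ℂ) (z₀ := 0) analyticAt_id p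
    simpa [Pi.pow_def] using! this
  have hσ2 : analyticOrderAt (fun t => (σ t).2) 0 = q' := analyticOrderAt_pow_mul_unit hh
  apply le_antisymm
  · have hf : AnalyticAt ℂ (fun z => (L (Ψ z)).2) 0 :=
      (analyticAt_snd.comp (L.toContinuousLinearMap.analyticAt _)).fun_comp hΨ
    have hn : analyticOrderAt (fun t => (L (Ψ (σ t))).2) 0 = q := by
      rw [← h2]
      apply analyticOrderAt_congr
      have ht : Tendsto (fun t => γ (τ t)) (𝓝 0) (𝓝 0) := by
        simpa [hγτ0] using hγτ.continuousAt.tendsto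
      filter_upwards [he, ht.eventually hΨe] with t h1 h2
      rw [show σ t = Φ (γ (τ t)) from h1.symm, h2]
    have := analyticOrderAt_snd_le_of_not_dvd hf hσa hσ0 hσ1 hn hpq
    rw [hσ2] at this
    exact_mod_cast this
  · have hf : AnalyticAt ℂ (fun z => (Φ (L.symm z)).2) 0 :=
      analyticAt_snd.fun_comp (AnalyticAt.comp (g := Φ) (by simpa using hΦ) hLs)
    have hn : analyticOrderAt (fun t => (Φ (L.symm (L (γ (τ t))))).2) 0 = q' := by
      rw [← hσ2]
      apply analyticOrderAt_congr
      filter_upwards [he] with t h1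
      rw [L.symm_apply_apply, h1]
    have := analyticOrderAt_snd_le_of_not_dvd hf hL (by simp [hτ0, h0]) h1 hn hpq'
    rw [h2] at this
    exact_mod_cast this

theorem exists_analytic_pow_eq {x : ℂ → ℂ} {p : ℕ} (hp0 : p ≠ 0) (hx : AnalyticAt ℂ x 0)
    (hp : analyticOrderAt x 0 = p) :
    ∃ ρ : ℂ → ℂ, AnalyticAt ℂ ρ 0 ∧ ρ 0 = 0 ∧ deriv ρ 0 ≠ 0 ∧ ∀ᶠ t in 𝓝 0, x t = ρ t ^ p := by
  obtain ⟨u, hu, hu0, hxu⟩ := hx.analyticOrderAt_eq_natCast.1 hp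
  -- Dividing by `u 0` moves the values near `1`, where the principal power is analytic.
  set v : ℂ → ℂ := fun t => (u 0) ^ ((p : ℂ)⁻¹) * (u t / u 0) ^ ((p : ℂ)⁻¹) with hv
  have hva : AnalyticAt ℂ v 0 :=
    analyticAt_const.mul ((hu.div_const).cpow analyticAt_const (by simp [hu0]))
  have hv0 : v 0 ≠ 0 := by
    simp [hv, hu0, hp0]
  have hd : HasDerivAt (fun t => t * v t) (v 0) 0 := by
    simpa using! (hasDerivAt_id (0 : ℂ)).mul hva.differentiableAt.hasDerivAt
  refine ⟨fun t => t * v t, analyticAt_id.mul hva, by simp, by rwa [hd.deriv], ?_⟩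
  filter_upwards [hxu] with t ht
  rw [ht, sub_zero, mul_pow, hv]
  simp only [mul_pow, Complex.cpow_nat_inv_pow _ hp0, smul_eq_mul]
  rw [mul_div_cancel₀ _ hu0]

/-- A `p`-th root of the first coordinate serves as the new parameter, and rescaling the second
coordinate makes its leading coefficient `1`. -/
theorem hasPuiseuxPair_of_order {γ : ℂ → ℂ × ℂ} {p q : ℕ} (L : (ℂ × ℂ) ≃L[ℂ] (ℂ × ℂ))
    (hγ : AnalyticAt ℂ γ 0) (hp0 : p ≠ 0)
    (hp : analyticOrderAt (fun t => (L (γ t)).1) 0 = p)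
    (hq : analyticOrderAt (fun t => (L (γ t)).2) 0 = q) (hlt : p < q) (hpq : ¬ p ∣ q) :
    HasPuiseuxPair γ p q := by
  have hL : AnalyticAt ℂ (fun t => L (γ t)) 0 := (L.toContinuousLinearMap.analyticAt _).fun_comp hγ
  obtain ⟨ρ, hρ, hρ0, hρ', hxρ⟩ := exists_analytic_pow_eq hp0 (analyticAt_fst.fun_comp hL) hp
  set τ := hρ.hasStrictDerivAt.localInverse _ _ _ hρ' with hτ
  have hτa : AnalyticAt ℂ τ 0 := by simpa [hρ0] using hρ.analyticAt_localInverse hρ'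
  have hρτ : ∀ᶠ t in 𝓝 0, ρ (τ t) = t := by
    simpa [hρ0] using hρ.hasStrictDerivAt.eventually_right_inverse hρ'
  have hτ0 : τ 0 = 0 := by
    have := (hρ.hasStrictDerivAt.eventually_left_inverse hρ').self_of_nhds
    rwa [hρ0] at this
  have hτ' : deriv τ 0 ≠ 0 := by
    have := (hρ.hasStrictDerivAt.to_localInverse hρ').hasDerivAt.deriv
    rw [hρ0] at this
    rw [hτ, this]
    exact inv_ne_zero hρ'
  have hw : analyticOrderAt (fun t => (L (γ (τ t))).2) 0 = q := by
    rw [← hq]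
    simpa [hτ0] using! analyticOrderAt_comp_of_deriv_ne_zero (f := fun t => (L (γ t)).2) hτa hτ'
  have hγτ : AnalyticAt ℂ (fun t => L (γ (τ t))) 0 :=
    AnalyticAt.comp (g := fun t => L (γ t)) (by rwa [hτ0]) hτa
  obtain ⟨g, hg, hg0, hwg⟩ := (analyticAt_snd.fun_comp hγτ).analyticOrderAt_eq_natCast.1 hw
  obtain ⟨h, hh, hgh⟩ : ∃ h : ℂ → ℂ, AnalyticAt ℂ h 0 ∧ ∀ᶠ t in 𝓝 0, g t - g 0 = t * h t := by
    have hga : AnalyticAt ℂ (fun t => g t - g 0) 0 := hg.sub analyticAt_const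
    have h1 : ((1 : ℕ) : ℕ∞) ≤ analyticOrderAt (fun t => g t - g 0) 0 := by
      have := (hga.analyticOrderAt_ne_zero).2 (sub_self (g 0))
      simpa [Order.one_le_iff_ne_zero] using this
    simpa using (natCast_le_analyticOrderAt hga).1 h1
  let M : (ℂ × ℂ) ≃L[ℂ] (ℂ × ℂ) := L.trans
    ((ContinuousLinearEquiv.refl ℂ ℂ).prodCongr
      (ContinuousLinearEquiv.unitsEquivAut ℂ (Units.mk0 (g 0)⁻¹ (inv_ne_zero hg0))))
  have hM : ∀ z, M z = ((L z).1, (L z).2 * (g 0)⁻¹) := fun z => rfl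
  refine ⟨hlt, hpq, M, τ, fun t => h t * (g 0)⁻¹,
    ⟨M.toContinuousLinearMap.analyticAt _, M.map_zero, ?_⟩, ⟨hτa, hτ0, hτ'⟩,
    hh.mul analyticAt_const, ?_⟩
  · have : fderiv ℂ (⇑M) 0 = M.toContinuousLinearMap := M.fderiv
    rw [this]
    exact M.bijective
  · have ht : Tendsto τ (𝓝 0) (𝓝 0) := by simpa [hτ0] using hτa.continuousAt.tendsto
    filter_upwards [hρτ, ht.eventually hxρ, hwg, hgh] with t h1 h2 h3 h4
    rw [hM, h2, h1, h3, sub_zero, smul_eq_mul, ← sub_add_cancel (g t) (g 0), h4]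
    congr 1
    field_simp
    ring

/-! ### Lifts by one blowing-up -/

theorem blowChart_infty (z : ℂ × ℂ) : blowChart OnePoint.infty z = (z.1 * z.2, z.2) := rfl

theorem blowChart_coe (c : ℂ) (z : ℂ × ℂ) :
    blowChart (c : OnePoint ℂ) z = (z.1, z.1 * (z.2 + c)) := rfl

theorem blowChart_zero (l : OnePoint ℂ) : blowChart l 0 = 0 := by
  cases l <;> simp [blowChart_infty, blowChart_coe]

theorem analyticAt_blowChart_comp (l : OnePoint ℂ) {σ : ℂ → ℂ × ℂ} (h : AnalyticAt ℂ σ 0) :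
    AnalyticAt ℂ (fun t => blowChart l (σ t)) 0 := by
  have h1 := analyticAt_fst.fun_comp h
  have h2 := analyticAt_snd.fun_comp h
  cases l with
  | infty => exact (h1.mul h2).prod h2
  | coe c => exact h1.prod (h1.mul (h2.add analyticAt_const))

theorem isLift_comp_blowChart_iff {Φ : ℂ × ℂ → ℂ × ℂ} {l : OnePoint ℂ} {σ σ' : ℂ → ℂ × ℂ} :
    IsLift (Φ ∘ blowChart l) σ σ' ↔ ∃ τ, IsLift Φ σ τ ∧ IsLift (blowChart l) τ σ' := by
  constructor
  · rintro ⟨h, h0, he⟩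
    exact ⟨fun t => blowChart l (σ' t),
      ⟨analyticAt_blowChart_comp l h, by simp [h0, blowChart_zero], he⟩,
      h, h0, Eventually.of_forall fun _ => rfl⟩
  · rintro ⟨τ, ⟨-, -, he⟩, h, h0, he'⟩
    refine ⟨h, h0, ?_⟩
    filter_upwards [he, he'] with t h1 h2
    rw [h1, h2, Function.comp_apply]

theorem isLift_id_iff {σ σ' : ℂ → ℂ × ℂ} :
    IsLift id σ σ' ↔ AnalyticAt ℂ σ' 0 ∧ σ' 0 = 0 ∧ σ =ᶠ[𝓝 0] σ' := Iff.rfl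

/-! ### Coordinate axes -/

/-- The axis `u = 0`. -/
def verticalAxis (t : ℂ) : ℂ × ℂ := (0, t)

/-- The axis `v = 0`. -/
def horizontalAxis (t : ℂ) : ℂ × ℂ := (t, 0)

theorem analyticAt_verticalAxis : AnalyticAt ℂ verticalAxis 0 :=
  analyticAt_const.prod analyticAt_id

theorem analyticAt_horizontalAxis : AnalyticAt ℂ horizontalAxis 0 :=
  analyticAt_id.prod analyticAt_const

theorem deriv_verticalAxis : deriv verticalAxis 0 = (0, 1) :=
  ((hasDerivAt_const (0 : ℂ) (0 : ℂ)).prodMk (hasDerivAt_id (0 : ℂ))).deriv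

theorem deriv_horizontalAxis : deriv horizontalAxis 0 = (1, 0) :=
  ((hasDerivAt_id (0 : ℂ)).prodMk (hasDerivAt_const (0 : ℂ) (0 : ℂ))).deriv

theorem excCurve_infty : excCurve OnePoint.infty = horizontalAxis := rfl

theorem excCurve_coe (c : ℂ) : excCurve (c : OnePoint ℂ) = verticalAxis := rfl

theorem Eventually.exists_ne_zero {P : ℂ → Prop} (h : ∀ᶠ t in 𝓝 (0 : ℂ), P t) :
    ∃ t, t ≠ 0 ∧ P t := by
  obtain ⟨t, h1, h2⟩ := ((h.filter_mono nhdsWithin_le_nhds).and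
    (self_mem_nhdsWithin (a := (0 : ℂ)) (s := {0}ᶜ))).exists
  exact ⟨t, h2, h1⟩

/-- The affine charts contract `u = 0` to the origin, so only the chart at `∞` can see the strict
transform of this axis. -/
theorem isLift_blowChart_vertical_iff {l : OnePoint ℂ} {σ σ' : ℂ → ℂ × ℂ}
    (hσ : σ =ᶠ[𝓝 0] verticalAxis) :
    IsLift (blowChart l) σ σ' ↔ l = OnePoint.infty ∧ σ' =ᶠ[𝓝 0] verticalAxis := by
  constructor
  · rintro ⟨-, h0, he⟩
    cases l with
    | coe c =>
      obtain ⟨t, ht, h1, h2⟩ := Eventually.exists_ne_zero (he.and hσ)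
      rw [h2, blowChart_coe, verticalAxis, Prod.mk.injEq] at h1
      exact absurd (by rw [h1.2, ← h1.1, zero_mul]) ht
    | infty =>
      refine ⟨rfl, ?_⟩
      filter_upwards [he, hσ] with t h1 h2
      rw [h2, blowChart_infty, verticalAxis, Prod.mk.injEq] at h1
      rcases eq_or_ne t 0 with rfl | ht
      · rw [h0]; rfl
      · refine Prod.ext ?_ h1.2.symm
        exact (mul_eq_zero.1 h1.1.symm).resolve_right (h1.2 ▸ ht)
  · rintro ⟨rfl, h⟩
    refine ⟨analyticAt_verticalAxis.congr h.symm, h.self_of_nhds, ?_⟩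
    filter_upwards [hσ, h] with t h1 h2
    simp [h1, h2, verticalAxis, blowChart_infty]

theorem isLift_blowChart_horizontal_iff {l : OnePoint ℂ} {σ σ' : ℂ → ℂ × ℂ}
    (hσ : σ =ᶠ[𝓝 0] horizontalAxis) :
    IsLift (blowChart l) σ σ' ↔ l = ((0 : ℂ) : OnePoint ℂ) ∧ σ' =ᶠ[𝓝 0] horizontalAxis := by
  constructor
  · rintro ⟨ha, h0, he⟩
    cases l with
    | infty =>
      obtain ⟨t, ht, h1, h2⟩ := Eventually.exists_ne_zero (he.and hσ)
      rw [h2, blowChart_infty, horizontalAxis, Prod.mk.injEq] at h1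
      exact absurd (by rw [h1.1, ← h1.2, mul_zero]) ht
    | coe c =>
      have key : ∀ᶠ t in 𝓝 (0 : ℂ), (σ' t).1 = t ∧ (t ≠ 0 → (σ' t).2 = -c) := by
        filter_upwards [he, hσ] with t h1 h2
        rw [h2, blowChart_coe, horizontalAxis, Prod.mk.injEq] at h1
        refine ⟨h1.1.symm, fun ht => ?_⟩
        exact eq_neg_of_add_eq_zero_left ((mul_eq_zero.1 h1.2.symm).resolve_left (h1.1 ▸ ht))
      -- The second coordinate of the lift is `-c` off `t = 0`, and tends to `0` by continuity.
      have hc : c = 0 := by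
        have h1 : Tendsto (fun t => (σ' t).2) (𝓝[≠] 0) (𝓝 0) := by
          have := (analyticAt_snd.fun_comp ha).continuousAt.tendsto
          rw [h0] at this
          exact this.mono_left nhdsWithin_le_nhds
        have h2 : Tendsto (fun t => (σ' t).2) (𝓝[≠] 0) (𝓝 (-c)) := by
          refine tendsto_const_nhds.congr' ?_
          filter_upwards [nhdsWithin_le_nhds key, self_mem_nhdsWithin] with t h1 ht
          exact (h1.2 ht).symm
        simpa using (tendsto_nhds_unique h1 h2).symm
      subst hc
      refine ⟨rfl, ?_⟩
      filter_upwards [key] with t h1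
      rcases eq_or_ne t 0 with rfl | ht
      · rw [h0]; rfl
      · exact Prod.ext h1.1 (by simpa [horizontalAxis] using h1.2 ht)
  · rintro ⟨rfl, h⟩
    refine ⟨analyticAt_horizontalAxis.congr h.symm, h.self_of_nhds, ?_⟩
    filter_upwards [hσ, h] with t h1 h2
    simp [h1, h2, horizontalAxis, blowChart_coe]

/-! ### Exceptional components through a centre -/

/-- The component `D j` is the axis `u = 0` at `c i`. -/
def IsVertical (s : ℕ → OnePoint ℂ) (j i : ℕ) : Prop :=
  j < i ∧ s j ≠ OnePoint.infty ∧ ∀ k, j < k → k < i → s k = OnePoint.infty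

/-- The component `D j` is the axis `v = 0` at `c i`. -/
def IsHorizontal (s : ℕ → OnePoint ℂ) (j i : ℕ) : Prop :=
  j < i ∧ s j = OnePoint.infty ∧ ∀ k, j < k → k < i → s k = ((0 : ℂ) : OnePoint ℂ)

variable {s : ℕ → OnePoint ℂ} {i j k : ℕ}

theorem isVertical_succ (h : s j ≠ OnePoint.infty) : IsVertical s j (j + 1) :=
  ⟨by omega, h, fun k _ _ => by omega⟩

theorem isHorizontal_succ (h : s j = OnePoint.infty) : IsHorizontal s j (j + 1) :=
  ⟨by omega, h, fun k _ _ => by omega⟩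

theorem isVertical_succ_iff (hji : j < i) :
    IsVertical s j (i + 1) ↔ IsVertical s j i ∧ s i = OnePoint.infty := by
  constructor
  · rintro ⟨-, h1, h2⟩
    exact ⟨⟨hji, h1, fun k hk hk' => h2 k hk (by omega)⟩, h2 i hji (by omega)⟩
  · rintro ⟨⟨-, h1, h2⟩, h3⟩
    refine ⟨by omega, h1, fun k hk hk' => ?_⟩
    rcases (Nat.lt_succ_iff.1 hk').eq_or_lt with rfl | h
    · exact h3
    · exact h2 k hk h

theorem isHorizontal_succ_iff (hji : j < i) :
    IsHorizontal s j (i + 1) ↔ IsHorizontal s j i ∧ s i = ((0 : ℂ) : OnePoint ℂ) := by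
  constructor
  · rintro ⟨-, h1, h2⟩
    exact ⟨⟨hji, h1, fun k hk hk' => h2 k hk (by omega)⟩, h2 i hji (by omega)⟩
  · rintro ⟨⟨-, h1, h2⟩, h3⟩
    refine ⟨by omega, h1, fun k hk hk' => ?_⟩
    rcases (Nat.lt_succ_iff.1 hk').eq_or_lt with rfl | h
    · exact h3
    · exact h2 k hk h

theorem IsVertical.unique (hj : IsVertical s j i) (hk : IsVertical s k i) : j = k := by
  rcases lt_trichotomy j k with h | h | h
  · exact absurd (hj.2.2 k h hk.1) hk.2.1
  · exact h
  · exact absurd (hk.2.2 j h hj.1) hj.2.1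

theorem IsHorizontal.unique (hj : IsHorizontal s j i) (hk : IsHorizontal s k i) : j = k := by
  rcases lt_trichotomy j k with h | h | h
  · exact absurd ((hj.2.2 k h hk.1).symm.trans hk.2.1) (OnePoint.coe_ne_infty _)
  · exact h
  · exact absurd ((hk.2.2 j h hj.1).symm.trans hj.2.1) (OnePoint.coe_ne_infty _)

/-- Induction on the number of blowing-ups, each of which keeps an axis or loses it. From here on,
passing through a centre is a condition on `s` alone. -/
theorem isLift_composite_excCurve_iff (s : ℕ → OnePoint ℂ) (j : ℕ) :
    ∀ (k : ℕ) (σ : ℂ → ℂ × ℂ), IsLift (composite s (j + 1) k) (excCurve (s j)) σ ↔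
      (IsVertical s j (j + 1 + k) ∧ σ =ᶠ[𝓝 0] verticalAxis) ∨
      (IsHorizontal s j (j + 1 + k) ∧ σ =ᶠ[𝓝 0] horizontalAxis)
  | 0, σ => by
    rw [composite, isLift_id_iff]
    induction hs : s j using OnePoint.rec with
    | infty =>
      rw [excCurve_infty]
      constructor
      · exact fun h => Or.inr ⟨isHorizontal_succ hs, h.2.2.symm⟩
      · rintro (⟨h, -⟩ | ⟨-, h⟩)
        · exact absurd hs h.2.1
        · exact ⟨analyticAt_horizontalAxis.congr h.symm, h.self_of_nhds, h.symm⟩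
    | coe c =>
      rw [excCurve_coe]
      constructor
      · exact fun h => Or.inl ⟨isVertical_succ (by simp [hs]), h.2.2.symm⟩
      · rintro (⟨-, h⟩ | ⟨h, -⟩)
        · exact ⟨analyticAt_verticalAxis.congr h.symm, h.self_of_nhds, h.symm⟩
        · exact absurd (hs.symm.trans h.2.1) (OnePoint.coe_ne_infty _)
  | k + 1, σ => by
    rw [composite, isLift_comp_blowChart_iff, ← add_assoc, isVertical_succ_iff (by omega),
      isHorizontal_succ_iff (by omega)]
    constructor
    · rintro ⟨τ, h1, h2⟩
      rcases (isLift_composite_excCurve_iff s j k τ).1 h1 with ⟨h3, h4⟩ | ⟨h3, h4⟩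
      · obtain ⟨h5, h6⟩ := (isLift_blowChart_vertical_iff h4).1 h2
        exact Or.inl ⟨⟨h3, h5⟩, h6⟩
      · obtain ⟨h5, h6⟩ := (isLift_blowChart_horizontal_iff h4).1 h2
        exact Or.inr ⟨⟨h3, h5⟩, h6⟩
    · rintro (⟨⟨h1, h2⟩, h3⟩ | ⟨⟨h1, h2⟩, h3⟩)
      · exact ⟨verticalAxis, (isLift_composite_excCurve_iff s j k _).2 (Or.inl ⟨h1, .rfl⟩),
          (isLift_blowChart_vertical_iff .rfl).2 ⟨h2, h3⟩⟩
      · exact ⟨horizontalAxis, (isLift_composite_excCurve_iff s j k _).2 (Or.inr ⟨h1, .rfl⟩),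
          (isLift_blowChart_horizontal_iff .rfl).2 ⟨h2, h3⟩⟩

theorem isExcAt_iff {σ : ℂ → ℂ × ℂ} : IsExcAt s j i σ ↔
    (IsVertical s j i ∧ σ =ᶠ[𝓝 0] verticalAxis) ∨
    (IsHorizontal s j i ∧ σ =ᶠ[𝓝 0] horizontalAxis) := by
  by_cases h : j < i
  · obtain ⟨k, rfl⟩ := Nat.exists_eq_add_of_le (Nat.succ_le_of_lt h)
    rw [IsExcAt, ← isLift_composite_excCurve_iff]
    simp [Nat.succ_eq_add_one]
    omega
  · simp [IsExcAt, IsVertical, IsHorizontal, h]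

theorem excThrough_iff : ExcThrough s j i ↔ IsVertical s j i ∨ IsHorizontal s j i := by
  simp only [ExcThrough, isExcAt_iff]
  constructor
  · rintro ⟨σ, ⟨h, -⟩ | ⟨h, -⟩⟩
    exacts [Or.inl h, Or.inr h]
  · rintro (h | h)
    exacts [⟨_, Or.inl ⟨h, .rfl⟩⟩, ⟨_, Or.inr ⟨h, .rfl⟩⟩]

theorem ExcThrough.lt (h : ExcThrough s j i) : j < i := h.choose_spec.1

theorem excThrough_succ (s : ℕ → OnePoint ℂ) (j : ℕ) : ExcThrough s j (j + 1) := by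
  rw [excThrough_iff]
  by_cases h : s j = OnePoint.infty
  exacts [Or.inr (isHorizontal_succ h), Or.inl (isVertical_succ h)]

theorem ExcThrough.mono (h : ExcThrough s j k) (hji : j < i) (hik : i ≤ k) :
    ExcThrough s j i := by
  rw [excThrough_iff] at h ⊢
  exact h.imp (fun h => ⟨hji, h.2.1, fun l h1 h2 => h.2.2 l h1 (by omega)⟩)
    (fun h => ⟨hji, h.2.1, fun l h1 h2 => h.2.2 l h1 (by omega)⟩)

/-- The newest component `D i` occupies one axis at `c (i + 1)`, and the other axis can be only one
component. -/
theorem ExcThrough.unique (hj : ExcThrough s j (i + 1)) (hk : ExcThrough s k (i + 1))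
    (hji : j < i) (hki : k < i) : j = k := by
  rw [excThrough_iff] at hj hk
  rcases excThrough_iff.1 (excThrough_succ s i) with h | h
  · have hj' := hj.resolve_left fun h' => hji.ne (h'.unique h)
    have hk' := hk.resolve_left fun h' => hki.ne (h'.unique h)
    exact hj'.unique hk'
  · have hj' := hj.resolve_right fun h' => hji.ne (h'.unique h)
    have hk' := hk.resolve_right fun h' => hki.ne (h'.unique h)
    exact hj'.unique hk'

theorem not_isVertical_and_isHorizontal (h : IsVertical s j i) (h' : IsHorizontal s j i) :
    False := h.2.1 h'.2.1

theorem finite_setOf_excThrough (s : ℕ → OnePoint ℂ) (i : ℕ) : {j | ExcThrough s j i}.Finite :=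
  (Set.finite_lt_nat i).subset fun _ h => h.lt

/-! ### The dual graph -/

theorem mem_component_iff {N : ℕ} {P : ℕ × OnePoint ℂ} : P ∈ component s N i ↔
    P ∈ divisorPoints s N ∧ (P.1 = i ∨ (IsVertical s i P.1 ∧ P.2 = OnePoint.infty) ∨
      (IsHorizontal s i P.1 ∧ P.2 = ((0 : ℂ) : OnePoint ℂ))) := by
  have key : (i + 1 ≤ P.1 ∧ ∃ σ', IsLift (composite s (i + 1) (P.1 - (i + 1)) ∘ blowChart P.2)
      (excCurve (s i)) σ') ↔ (IsVertical s i P.1 ∧ P.2 = OnePoint.infty) ∨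
      (IsHorizontal s i P.1 ∧ P.2 = ((0 : ℂ) : OnePoint ℂ)) := by
    constructor
    · rintro ⟨hi, σ', h⟩
      obtain ⟨τ, h1, h2⟩ := isLift_comp_blowChart_iff.1 h
      rw [isLift_composite_excCurve_iff, Nat.add_sub_cancel' hi] at h1
      rcases h1 with ⟨h3, h4⟩ | ⟨h3, h4⟩
      · exact Or.inl ⟨h3, ((isLift_blowChart_vertical_iff h4).1 h2).1⟩
      · exact Or.inr ⟨h3, ((isLift_blowChart_horizontal_iff h4).1 h2).1⟩
    · rintro (⟨h1, h2⟩ | ⟨h1, h2⟩)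
      · refine ⟨h1.1, verticalAxis, isLift_comp_blowChart_iff.2 ⟨verticalAxis, ?_,
          (isLift_blowChart_vertical_iff .rfl).2 ⟨h2, .rfl⟩⟩⟩
        rw [isLift_composite_excCurve_iff, Nat.add_sub_cancel' h1.1]
        exact Or.inl ⟨h1, .rfl⟩
      · refine ⟨h1.1, horizontalAxis, isLift_comp_blowChart_iff.2 ⟨horizontalAxis, ?_,
          (isLift_blowChart_horizontal_iff .rfl).2 ⟨h2, .rfl⟩⟩⟩
        rw [isLift_composite_excCurve_iff, Nat.add_sub_cancel' h1.1]
        exact Or.inr ⟨h1, .rfl⟩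
  simp only [component, strictPoints, Set.mem_union, Set.mem_ofPred_eq, key]
  tauto

/-- Two components meet if and only if the later centre lies on the earlier component, which does
not pass through the next centre. -/
theorem component_inter_nonempty_iff {N : ℕ} (hij : i < j) (hj : j < N) :
    (component s N i ∩ component s N j).Nonempty ↔
      ExcThrough s i j ∧ (j + 1 < N → ¬ ExcThrough s i (j + 1)) := by
  constructor
  · rintro ⟨⟨m, l⟩, h1, h2⟩
    rw [mem_component_iff] at h1 h2
    obtain ⟨hd, h1⟩ := h1
    obtain ⟨-, h2⟩ := h2
    simp only at h1 h2
    -- At a later level the point would lie on two strict transforms: either both are the same axis,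
    -- excluded by uniqueness, or the point is both `0` and `∞`.
    have hm : m = j := by
      by_contra hne
      replace h2 := h2.resolve_left hne
      have hmi : m ≠ i := by
        rintro rfl
        rcases h2 with h2 | h2 <;> exact absurd h2.1.1 (by omega)
      replace h1 := h1.resolve_left hmi
      rcases h1 with ⟨h3, rfl⟩ | ⟨h3, rfl⟩ <;> rcases h2 with ⟨h4, h5⟩ | ⟨h4, h5⟩
      · exact hij.ne (h3.unique h4)
      · exact absurd h5 (OnePoint.infty_ne_coe _)
      · exact absurd h5 (OnePoint.coe_ne_infty _)
      · exact hij.ne (h3.unique h4)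
    subst hm
    replace h1 := h1.resolve_left hij.ne'
    refine ⟨excThrough_iff.2 (h1.imp And.left And.left), fun hlt h => hd.2 hlt ?_⟩
    rw [excThrough_iff, isVertical_succ_iff hij, isHorizontal_succ_iff hij] at h
    simp only
    rcases h1 with ⟨h3, rfl⟩ | ⟨h3, rfl⟩ <;> rcases h with ⟨h4, h5⟩ | ⟨h4, h5⟩
    · exact h5.symm
    · exact (not_isVertical_and_isHorizontal h3 h4).elim
    · exact (not_isVertical_and_isHorizontal h4 h3).elim
    · exact h5.symm
  · rintro ⟨h1, h2⟩
    rw [excThrough_iff, isVertical_succ_iff hij, isHorizontal_succ_iff hij] at h2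
    rcases excThrough_iff.1 h1 with h | h
    · have hd : (j, OnePoint.infty) ∈ divisorPoints s N :=
        ⟨hj, fun hlt he => h2 hlt (Or.inl ⟨h, he.symm⟩)⟩
      exact ⟨_, mem_component_iff.2 ⟨hd, Or.inr (Or.inl ⟨h, rfl⟩)⟩,
        mem_component_iff.2 ⟨hd, Or.inl rfl⟩⟩
    · have hd : (j, ((0 : ℂ) : OnePoint ℂ)) ∈ divisorPoints s N :=
        ⟨hj, fun hlt he => h2 hlt (Or.inr ⟨h, he.symm⟩)⟩
      exact ⟨_, mem_component_iff.2 ⟨hd, Or.inr (Or.inr ⟨h, rfl⟩)⟩,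
        mem_component_iff.2 ⟨hd, Or.inl rfl⟩⟩

end PlaneBranch

namespace PlaneBranch

/-! ### Orders of the coordinates along a germ -/

/-- The order of the first coordinate along a germ. -/
noncomputable def fstOrder (γ : ℂ → ℂ × ℂ) : ℕ∞ := analyticOrderAt (fun t => (γ t).1) 0

/-- The order of the second coordinate along a germ. -/
noncomputable def sndOrder (γ : ℂ → ℂ × ℂ) : ℕ∞ := analyticOrderAt (fun t => (γ t).2) 0

variable {γ σ : ℂ → ℂ × ℂ}

theorem fstOrder_ne_zero (h : AnalyticAt ℂ γ 0) (h0 : γ 0 = 0) : fstOrder γ ≠ 0 :=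
  ((analyticAt_fst.fun_comp h).analyticOrderAt_ne_zero).2 (by rw [h0]; rfl)

theorem sndOrder_ne_zero (h : AnalyticAt ℂ γ 0) (h0 : γ 0 = 0) : sndOrder γ ≠ 0 :=
  ((analyticAt_snd.fun_comp h).analyticOrderAt_ne_zero).2 (by rw [h0]; rfl)

theorem IsLift.sndOrder_infty (h : IsLift (blowChart OnePoint.infty) γ σ) :
    sndOrder γ = sndOrder σ :=
  analyticOrderAt_congr (h.2.2.mono fun t ht => by simp [ht, blowChart_infty])

theorem IsLift.fstOrder_infty (h : IsLift (blowChart OnePoint.infty) γ σ) :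
    fstOrder γ = fstOrder σ + sndOrder σ := by
  rw [fstOrder, fstOrder, sndOrder,
    ← analyticOrderAt_mul (analyticAt_fst.fun_comp h.1) (analyticAt_snd.fun_comp h.1)]
  exact analyticOrderAt_congr (h.2.2.mono fun t ht => by simp [ht, blowChart_infty])

theorem IsLift.fstOrder_coe {c : ℂ} (h : IsLift (blowChart c) γ σ) :
    fstOrder γ = fstOrder σ :=
  analyticOrderAt_congr (h.2.2.mono fun t ht => by simp [ht, blowChart_coe])

theorem IsLift.sub_order_coe {c : ℂ} (h : IsLift (blowChart c) γ σ) :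
    analyticOrderAt (fun t => (γ t).2 - c * (γ t).1) 0 = fstOrder σ + sndOrder σ := by
  rw [fstOrder, sndOrder,
    ← analyticOrderAt_mul (analyticAt_fst.fun_comp h.1) (analyticAt_snd.fun_comp h.1)]
  refine analyticOrderAt_congr (h.2.2.mono fun t ht => ?_)
  simp only [ht, blowChart_coe, Pi.mul_apply]
  ring

theorem IsLift.sndOrder_zero (h : IsLift (blowChart ((0 : ℂ) : OnePoint ℂ)) γ σ) :
    sndOrder γ = fstOrder σ + sndOrder σ := by
  simpa using! h.sub_order_coe

theorem IsLift.fstOrder_le_sndOrder {l : OnePoint ℂ} (hl : l ≠ OnePoint.infty)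
    (h : IsLift (blowChart l) γ σ) : fstOrder γ ≤ sndOrder γ := by
  cases l with
  | infty => exact absurd rfl hl
  | coe c =>
    have h1 := analyticAt_fst.fun_comp h.1
    have h2 : AnalyticAt ℂ (fun t => (σ t).2 + c) 0 :=
      (analyticAt_snd.fun_comp h.1).add analyticAt_const
    have : sndOrder γ = fstOrder σ + analyticOrderAt (fun t => (σ t).2 + c) 0 := by
      rw [fstOrder, sndOrder, ← analyticOrderAt_mul h1 h2]
      exact analyticOrderAt_congr (h.2.2.mono fun t ht => by simp [ht, blowChart_coe])
    rw [this, h.fstOrder_coe]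
    exact le_self_add

/-- The default value of `toNat` at `⊤` occurs only if both coordinates vanish identically. -/
theorem natCast_mult (h : ¬ ∀ᶠ t in 𝓝 0, γ t = 0) :
    (mult γ : ℕ∞) = min (fstOrder γ) (sndOrder γ) := by
  refine ENat.natCast_toNat fun htop => h ?_
  rw [min_eq_top, analyticOrderAt_eq_top, analyticOrderAt_eq_top] at htop
  filter_upwards [htop.1, htop.2] with t h1 h2
  exact Prod.ext h1 h2

/-! ### Smooth germs -/

theorem deriv_fst (h : AnalyticAt ℂ γ 0) : deriv (fun t => (γ t).1) 0 = (deriv γ 0).1 :=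
  ((hasFDerivAt_fst (𝕜 := ℂ) (p := γ 0)).comp_hasDerivAt (0 : ℂ)
    h.differentiableAt.hasDerivAt).deriv

theorem deriv_snd (h : AnalyticAt ℂ γ 0) : deriv (fun t => (γ t).2) 0 = (deriv γ 0).2 :=
  ((hasFDerivAt_snd (𝕜 := ℂ) (p := γ 0)).comp_hasDerivAt (0 : ℂ)
    h.differentiableAt.hasDerivAt).deriv

theorem analyticOrderAt_eq_one_iff {f : ℂ → ℂ} (h : AnalyticAt ℂ f 0) (h0 : f 0 = 0) :
    analyticOrderAt f 0 = 1 ↔ deriv f 0 ≠ 0 := by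
  have := analyticOrderAt_deriv_eq_iff h h0 (n := 0)
  rw [Nat.cast_zero, zero_add, h.deriv.analyticOrderAt_eq_zero] at this
  exact this

theorem fstOrder_eq_one_iff (h : AnalyticAt ℂ γ 0) (h0 : γ 0 = 0) :
    fstOrder γ = 1 ↔ (deriv γ 0).1 ≠ 0 := by
  rw [← deriv_fst h]
  exact analyticOrderAt_eq_one_iff (analyticAt_fst.fun_comp h) (by rw [h0]; rfl)

theorem sndOrder_eq_one_iff (h : AnalyticAt ℂ γ 0) (h0 : γ 0 = 0) :
    sndOrder γ = 1 ↔ (deriv γ 0).2 ≠ 0 := by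
  rw [← deriv_snd h]
  exact analyticOrderAt_eq_one_iff (analyticAt_snd.fun_comp h) (by rw [h0]; rfl)

theorem isSmoothGerm_of_mult_eq_one (h : AnalyticAt ℂ γ 0) (h0 : γ 0 = 0)
    (hne : ¬ ∀ᶠ t in 𝓝 0, γ t = 0) (hm : mult γ = 1) : IsSmoothGerm γ := by
  refine ⟨h, h0, fun hd => ?_⟩
  have h1 := natCast_mult hne
  rw [hm, Nat.cast_one] at h1
  rcases min_choice (fstOrder γ) (sndOrder γ) with h2 | h2
  · rw [h2] at h1
    exact (fstOrder_eq_one_iff h h0).1 h1.symm (by rw [hd]; rfl)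
  · rw [h2] at h1
    exact (sndOrder_eq_one_iff h h0).1 h1.symm (by rw [hd]; rfl)

theorem IsLift.deriv_infty (h : IsLift (blowChart OnePoint.infty) γ σ) :
    deriv γ 0 = (0, (deriv σ 0).2) := by
  have h1 := (analyticAt_fst.fun_comp h.1).differentiableAt.hasDerivAt
  have h2 := (analyticAt_snd.fun_comp h.1).differentiableAt.hasDerivAt
  rw [EventuallyEq.deriv_eq h.2.2]
  have := ((h1.mul h2).prodMk h2).deriv
  rw [h.2.1, deriv_snd h.1] at this
  simpa [blowChart_infty] using! this

theorem IsLift.deriv_coe {c : ℂ} (h : IsLift (blowChart c) γ σ) :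
    deriv γ 0 = ((deriv σ 0).1, (deriv σ 0).1 * c) := by
  have h1 := (analyticAt_fst.fun_comp h.1).differentiableAt.hasDerivAt
  have h2 := (analyticAt_snd.fun_comp h.1).differentiableAt.hasDerivAt
  rw [EventuallyEq.deriv_eq h.2.2]
  have := (h1.prodMk (h1.mul (h2.add_const c))).deriv
  rw [h.2.1, deriv_fst h.1] at this
  simpa [blowChart_coe] using! this

theorem IsSmoothGerm.lift {l : OnePoint ℂ} (hγ : IsSmoothGerm γ) (h : IsLift (blowChart l) γ σ) :
    IsSmoothGerm σ := by
  refine ⟨h.1, h.2.1, fun hd => hγ.2.2 ?_⟩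
  cases l with
  | infty => rw [h.deriv_infty, hd]; rfl
  | coe c => rw [h.deriv_coe, hd]; simp

/-- Both coordinates are divisible by `t`, and the quotient of the remaining factors is analytic in
one of the two orders; its value at `0` is the tangent direction. -/
theorem IsSmoothGerm.exists_lift (hγ : IsSmoothGerm γ) :
    ∃ l σ, IsLift (blowChart l) γ σ := by
  obtain ⟨ha, h0, hd⟩ := hγ
  have factor : ∀ f : ℂ → ℂ, AnalyticAt ℂ f 0 → f 0 = 0 →
      ∃ g : ℂ → ℂ, AnalyticAt ℂ g 0 ∧ g 0 = deriv f 0 ∧ ∀ᶠ t in 𝓝 0, f t = t * g t := by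
    intro f hf hf0
    have h1 : ((1 : ℕ) : ℕ∞) ≤ analyticOrderAt f 0 := by
      simpa [Order.one_le_iff_ne_zero] using hf.analyticOrderAt_ne_zero.2 hf0
    obtain ⟨g, hg, hfg⟩ := (natCast_le_analyticOrderAt hf).1 h1
    have hfg' : ∀ᶠ t in 𝓝 0, f t = t * g t := by simpa using hfg
    refine ⟨g, hg, ?_, hfg'⟩
    have := (hasDerivAt_id (0 : ℂ)).mul hg.differentiableAt.hasDerivAt
    rw [EventuallyEq.deriv_eq hfg']
    simpa using! this.deriv.symm
  obtain ⟨f, hf, hf0, hfe⟩ := factor _ (analyticAt_fst.fun_comp ha) (by rw [h0]; rfl)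
  obtain ⟨g, hg, hg0, hge⟩ := factor _ (analyticAt_snd.fun_comp ha) (by rw [h0]; rfl)
  rw [deriv_fst ha] at hf0
  rw [deriv_snd ha] at hg0
  by_cases hd1 : (deriv γ 0).1 = 0
  · have hg0' : g 0 ≠ 0 := by
      rw [hg0]
      exact fun h => hd (Prod.ext hd1 h)
    refine ⟨OnePoint.infty, fun t => (f t / g t, (γ t).2),
      (hf.div hg hg0').prod (analyticAt_snd.fun_comp ha), ?_, ?_⟩
    · simp [hf0, hd1, h0]
    · filter_upwards [hfe, hge, hg.continuousAt.eventually_ne hg0'] with t h1 h2 h3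
      rw [blowChart_infty]
      refine Prod.ext ?_ rfl
      rw [h1, h2]
      field_simp
  · have hf0' : f 0 ≠ 0 := by rwa [hf0]
    refine ⟨((g 0 / f 0 : ℂ) : OnePoint ℂ), fun t => ((γ t).1, g t / f t - g 0 / f 0),
      (analyticAt_fst.fun_comp ha).prod ((hg.div hf hf0').sub analyticAt_const), ?_, ?_⟩
    · simp [h0]
    · filter_upwards [hfe, hge, hf.continuousAt.eventually_ne hf0'] with t h1 h2 h3
      rw [blowChart_coe]
      refine Prod.ext rfl ?_
      rw [h1, h2]
      field_simp
      ring

theorem transverse_iff_of_vertical (hσ : deriv σ 0 = (0, 1)) :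
    Transverse γ σ ↔ (deriv γ 0).1 ≠ 0 := by
  rw [Transverse, hσ, LinearIndependent.pair_iff]
  constructor
  · intro h h0
    have := h 1 (-(deriv γ 0).2) (by ext <;> simp [h0])
    exact one_ne_zero this.1
  · intro h a b hab
    have h1 : a * (deriv γ 0).1 = 0 := by simpa using congrArg Prod.fst hab
    have h2 : a * (deriv γ 0).2 + b = 0 := by simpa using congrArg Prod.snd hab
    have ha := (mul_eq_zero.1 h1).resolve_right h
    exact ⟨ha, by simpa [ha] using h2⟩

theorem transverse_iff_of_horizontal (hσ : deriv σ 0 = (1, 0)) :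
    Transverse γ σ ↔ (deriv γ 0).2 ≠ 0 := by
  rw [Transverse, hσ, LinearIndependent.pair_iff]
  constructor
  · intro h h0
    have := h 1 (-(deriv γ 0).1) (by ext <;> simp [h0])
    exact one_ne_zero this.1
  · intro h a b hab
    have h1 : a * (deriv γ 0).1 + b = 0 := by simpa using congrArg Prod.fst hab
    have h2 : a * (deriv γ 0).2 = 0 := by simpa using congrArg Prod.snd hab
    have ha := (mul_eq_zero.1 h2).resolve_right h
    exact ⟨ha, by simpa [ha] using h1⟩

/-! ### Directions -/

variable {s : ℕ → OnePoint ℂ} {i j k : ℕ}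

/-- The strict transform of a germ passes through the centre `c i`. -/
def LiftsTo (s : ℕ → OnePoint ℂ) (γ : ℂ → ℂ × ℂ) (i : ℕ) : Prop :=
  ∃ σ, IsLift (composite s 0 i) γ σ

theorem IsSmoothGerm.liftsTo_zero (hγ : IsSmoothGerm γ) : LiftsTo s γ 0 :=
  ⟨γ, hγ.1, hγ.2.1, Eventually.of_forall fun _ => rfl⟩

theorem isLift_composite_succ_iff : IsLift (composite s 0 (i + 1)) γ σ ↔
    ∃ τ, IsLift (composite s 0 i) γ τ ∧ IsLift (blowChart (s i)) τ σ := by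
  rw [composite, isLift_comp_blowChart_iff, zero_add]

theorem LiftsTo.mono (h : LiftsTo s γ k) (hik : i ≤ k) : LiftsTo s γ i := by
  induction hik with
  | refl => exact h
  | step _ ih =>
    obtain ⟨σ, hσ⟩ := h
    obtain ⟨τ, hτ, -⟩ := isLift_composite_succ_iff.1 hσ
    exact ih ⟨τ, hτ⟩

theorem IsSmoothGerm.lift_composite (hγ : IsSmoothGerm γ) :
    ∀ {i : ℕ} {σ : ℂ → ℂ × ℂ}, IsLift (composite s 0 i) γ σ → IsSmoothGerm σ
  | 0, σ, h => by
    have he : γ =ᶠ[𝓝 0] σ := h.2.2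
    exact ⟨h.1, h.2.1, by rw [← he.deriv_eq]; exact hγ.2.2⟩
  | i + 1, σ, h => by
    obtain ⟨τ, hτ, h'⟩ := isLift_composite_succ_iff.1 h
    exact (hγ.lift_composite hτ).lift h'

/-- A smooth germ only passes through points of the last exceptional component. -/
theorem LiftsTo.eq_of_excThrough (hγ : IsSmoothGerm γ) (h : LiftsTo s γ i)
    (hj : ExcThrough s j i) : j + 1 = i := by
  by_contra hne
  have hji : j + 2 ≤ i := by have := hj.lt; omega
  obtain ⟨ρ, hρ⟩ := h.mono hji
  obtain ⟨σ, hσ, hσρ⟩ := isLift_composite_succ_iff.1 hρ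
  obtain ⟨τ, hτ, hτσ⟩ := isLift_composite_succ_iff.1 hσ
  have hd := (hγ.lift_composite hτ).2.2
  replace hj := hj.mono (by omega) hji
  rw [excThrough_iff, isVertical_succ_iff (by omega), isHorizontal_succ_iff (by omega)] at hj
  -- A lift to a point of `D j` at `c (j + 2)` makes the germ tangent to `D j` at `c (j + 1)`.
  -- Blowing down `D j` kills this tangent vector, against smoothness at `c j`.
  rcases hj with ⟨h1, h2⟩ | ⟨h1, h2⟩
  · rw [h2] at hσρ
    have hσd := hσρ.deriv_infty
    have := h1.2.1
    cases hs : s j with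
    | infty => exact this hs
    | coe c =>
      rw [hs] at hτσ
      exact hd (by rw [hτσ.deriv_coe, hσd]; simp)
  · rw [h2] at hσρ
    have hσd := hσρ.deriv_coe
    rw [h1.2.1] at hτσ
    exact hd (by rw [hτσ.deriv_infty, hσd]; simp)

/-- Both tangent vectors would lie on the line of direction `s 0`. -/
theorem Transverse.not_liftsTo (hγσ : Transverse γ σ) (hi : 1 ≤ i) (h : LiftsTo s γ i)
    (h' : LiftsTo s σ i) : False := by
  obtain ⟨τ, hτ⟩ := h.mono hi
  obtain ⟨τ', hτ'⟩ := h'.mono hi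
  have h1 : IsLift (blowChart (s 0)) γ τ := by simpa [composite] using hτ
  have h2 : IsLift (blowChart (s 0)) σ τ' := by simpa [composite] using hτ'
  rw [Transverse, LinearIndependent.pair_iff] at hγσ
  cases hs : s 0 with
  | infty =>
    rw [hs] at h1 h2
    have h := hγσ (deriv τ' 0).2 (-(deriv τ 0).2)
    rw [h1.deriv_infty, h2.deriv_infty] at h hγσ
    have h3 := h (by ext <;> simp; ring)
    have h4 := hγσ 1 0 (by simp [neg_eq_zero.1 h3.2])
    exact one_ne_zero h4.1
  | coe c =>
    rw [hs] at h1 h2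
    have h := hγσ (deriv τ' 0).1 (-(deriv τ 0).1)
    rw [h1.deriv_coe, h2.deriv_coe] at h hγσ
    have h3 := h (by ext <;> simp <;> ring)
    have h4 := hγσ 1 0 (by simp [neg_eq_zero.1 h3.2])
    exact one_ne_zero h4.1

/-- A smooth germ meets the component created by the blowing-up of the last centre on it. -/
theorem LiftsTo.strictPoints_inter_component {N : ℕ} (hγ : IsSmoothGerm γ) (h : LiftsTo s γ i)
    (hi : i < N) (h' : ¬ LiftsTo s γ (i + 1)) :
    (strictPoints s N 0 γ ∩ component s N i).Nonempty := by
  obtain ⟨σ, hσ⟩ := h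
  obtain ⟨l, τ, hτ⟩ := (hγ.lift_composite hσ).exists_lift
  have hd : (i, l) ∈ divisorPoints s N := by
    refine ⟨hi, fun _ hl => h' ⟨τ, isLift_composite_succ_iff.2 ⟨σ, hσ, ?_⟩⟩⟩
    simp only at hl
    rwa [← hl]
  exact ⟨(i, l), ⟨hd, Nat.zero_le _, τ, isLift_comp_blowChart_iff.2 ⟨σ, hσ, hτ⟩⟩,
    mem_component_iff.2 ⟨hd, Or.inl rfl⟩⟩

end PlaneBranch

namespace PlaneBranch

/-! ### Multiplicities of the infinitely near points -/

variable {S : ℂ → ℂ × ℂ} {s : ℕ → OnePoint ℂ} {T : ℕ → ℂ → ℂ × ℂ} {i j k N : ℕ}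

theorem IsBlowupSequence.analyticAt (hT : IsBlowupSequence S s T) (hS : IsBranch S) (i : ℕ) :
    AnalyticAt ℂ (T i) 0 ∧ T i 0 = 0 := by
  cases i with
  | zero => rw [hT.1]; exact ⟨hS.1, hS.2.1⟩
  | succ i => exact ⟨(hT.2 i).1, (hT.2 i).2.1⟩

theorem IsBlowupSequence.not_eventually_zero (hT : IsBlowupSequence S s T) (hS : IsBranch S) :
    ∀ i, ¬ ∀ᶠ t in 𝓝 0, T i t = 0
  | 0, h => by
    rw [hT.1] at h
    obtain ⟨-, h0, U, hU, hinj⟩ := hS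
    obtain ⟨t, ht, h1, h2⟩ := Eventually.exists_ne_zero (h.and hU)
    exact ht (hinj h2 (mem_of_mem_nhds hU) (by rw [h1, h0]))
  | i + 1, h => by
    refine hT.not_eventually_zero hS i ?_
    filter_upwards [h, (hT.2 i).2.2] with t h1 h2
    rw [h2, h1, blowChart_zero]

theorem IsBlowupSequence.natCast_mult (hT : IsBlowupSequence S s T) (hS : IsBranch S) (i : ℕ) :
    (mult (T i) : ℕ∞) = min (fstOrder (T i)) (sndOrder (T i)) :=
  PlaneBranch.natCast_mult (hT.not_eventually_zero hS i)

theorem IsBlowupSequence.mult_pos (hT : IsBlowupSequence S s T) (hS : IsBranch S) (i : ℕ) :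
    0 < mult (T i) := by
  obtain ⟨h, h0⟩ := hT.analyticAt hS i
  rw [pos_iff_ne_zero, ← Nat.cast_ne_zero (R := ℕ∞), hT.natCast_mult hS i]
  rcases min_choice (fstOrder (T i)) (sndOrder (T i)) with h' | h' <;> rw [h']
  exacts [fstOrder_ne_zero h h0, sndOrder_ne_zero h h0]

theorem IsBlowupSequence.mult_of_ne_infty (hT : IsBlowupSequence S s T) (hS : IsBranch S)
    (hi : s i ≠ OnePoint.infty) :
    (mult (T i) : ℕ∞) = fstOrder (T i) ∧ (mult (T i) : ℕ∞) = fstOrder (T (i + 1)) := by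
  have h := hT.2 i
  have h1 : (mult (T i) : ℕ∞) = fstOrder (T i) := by
    rw [hT.natCast_mult hS, min_eq_left (h.fstOrder_le_sndOrder hi)]
  refine ⟨h1, h1.trans ?_⟩
  cases hs : s i with
  | infty => exact absurd hs hi
  | coe c => rw [hs] at h; exact h.fstOrder_coe

theorem IsBlowupSequence.mult_of_eq_infty (hT : IsBlowupSequence S s T) (hS : IsBranch S)
    (hi : s i = OnePoint.infty) :
    (mult (T i) : ℕ∞) = sndOrder (T i) ∧ (mult (T i) : ℕ∞) = sndOrder (T (i + 1)) ∧
      fstOrder (T i) = fstOrder (T (i + 1)) + sndOrder (T (i + 1)) := by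
  have h := hT.2 i
  rw [hi] at h
  have h1 : (mult (T i) : ℕ∞) = sndOrder (T i) := by
    rw [hT.natCast_mult hS, min_eq_right]
    rw [h.sndOrder_infty, h.fstOrder_infty]
    exact le_add_self
  exact ⟨h1, h1.trans h.sndOrder_infty, h.fstOrder_infty⟩

/-- While `D j` is the axis `u = 0`, the order of `u` is its intersection number with the branch.
This equals `mult (T j)` at `c (j + 1)`, and each blowing-up lowers it by the multiplicity of the
centre. -/
theorem IsBlowupSequence.mult_eq_sum_add_fstOrder (hT : IsBlowupSequence S s T)
    (hS : IsBranch S) (h : IsVertical s j i) :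
    (mult (T j) : ℕ∞) = (∑ k ∈ Finset.Ioo j i, mult (T k) : ℕ) + fstOrder (T i) := by
  induction i, Nat.succ_le_of_lt h.1 using Nat.le_induction with
  | base =>
    have : Finset.Ioo j (j + 1) = ∅ := by ext; simp
    rw [Nat.succ_eq_add_one, this, Finset.sum_empty, Nat.cast_zero, zero_add]
    exact (hT.mult_of_ne_infty hS h.2.1).2
  | succ i hi ih =>
    obtain ⟨h1, h2⟩ := (isVertical_succ_iff hi).1 h
    have hI : Finset.Ioo j (i + 1) = insert i (Finset.Ioo j i) := by ext; simp; omega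
    obtain ⟨-, h3, h4⟩ := hT.mult_of_eq_infty hS h2
    rw [hI, Finset.sum_insert (by simp), ih h1, h4, Nat.cast_add, h3]
    ring

theorem IsBlowupSequence.mult_eq_sum_add_sndOrder (hT : IsBlowupSequence S s T)
    (hS : IsBranch S) (h : IsHorizontal s j i) :
    (mult (T j) : ℕ∞) = (∑ k ∈ Finset.Ioo j i, mult (T k) : ℕ) + sndOrder (T i) := by
  induction i, Nat.succ_le_of_lt h.1 using Nat.le_induction with
  | base =>
    have : Finset.Ioo j (j + 1) = ∅ := by ext; simp
    rw [Nat.succ_eq_add_one, this, Finset.sum_empty, Nat.cast_zero, zero_add]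
    exact (hT.mult_of_eq_infty hS h.2.1).2.1
  | succ i hi ih =>
    obtain ⟨h1, h2⟩ := (isHorizontal_succ_iff hi).1 h
    have hI : Finset.Ioo j (i + 1) = insert i (Finset.Ioo j i) := by ext; simp; omega
    have h3 := (hT.mult_of_ne_infty hS (h2 ▸ OnePoint.coe_ne_infty _ : s i ≠ OnePoint.infty)).2
    have h4 := hT.2 i
    rw [h2] at h4
    rw [hI, Finset.sum_insert (by simp), ih h1, h4.sndOrder_zero, Nat.cast_add, h3]
    ring

/-- At a point `c ≠ 0` one has `v = u (v' + c)` with `v' + c` a unit, so both coordinates have the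
same order. -/
theorem IsBlowupSequence.sndOrder_eq_mult (hT : IsBlowupSequence S s T) (hS : IsBranch S)
    (h' : s i ≠ ((0 : ℂ) : OnePoint ℂ)) :
    sndOrder (T i) = mult (T i) := by
  by_cases hi : s i = OnePoint.infty
  · exact (hT.mult_of_eq_infty hS hi).1.symm
  · have h1 := hT.mult_of_ne_infty hS hi
    have h2 := hT.2 i
    cases hs : s i with
    | infty => exact absurd hs hi
    | coe c =>
      rw [hs] at h2 h'
      have hc : c ≠ 0 := fun hc => h' (by rw [hc])
      have h3 : AnalyticAt ℂ (fun t => (T (i + 1) t).2 + c) 0 :=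
        (analyticAt_snd.fun_comp h2.1).add analyticAt_const
      have h4 : analyticOrderAt (fun t => (T (i + 1) t).2 + c) 0 = 0 :=
        h3.analyticOrderAt_eq_zero.2 (by simpa [h2.2.1] using hc)
      rw [h1.2, ← add_zero (fstOrder _), ← h4, fstOrder, sndOrder,
        ← analyticOrderAt_mul (analyticAt_fst.fun_comp h2.1) h3]
      exact analyticOrderAt_congr (h2.2.2.mono fun t ht => by simp [ht, blowChart_coe])

/-- The proximity equality. -/
theorem IsBlowupSequence.mult_eq_sum (hT : IsBlowupSequence S s T) (hS : IsBranch S)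
    (h : ExcThrough s j i) (h' : ¬ ExcThrough s j (i + 1)) :
    mult (T j) = ∑ k ∈ Finset.Ioc j i, mult (T k) := by
  have hI : Finset.Ioc j i = insert i (Finset.Ioo j i) := by
    have := h.lt
    ext; simp; omega
  rw [hI, Finset.sum_insert (by simp), add_comm, ← Nat.cast_inj (R := ℕ∞), Nat.cast_add]
  rw [excThrough_iff, isVertical_succ_iff h.lt, isHorizontal_succ_iff h.lt] at h'
  rcases excThrough_iff.1 h with h1 | h1
  · rw [hT.mult_eq_sum_add_fstOrder hS h1,
      (hT.mult_of_ne_infty hS fun hi => h' (Or.inl ⟨h1, hi⟩)).1]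
  · rw [hT.mult_eq_sum_add_sndOrder hS h1,
      hT.sndOrder_eq_mult hS fun hi => h' (Or.inr ⟨h1, hi⟩)]

/-- Along `D j` two consecutive blowing-ups use the same chart, so one and the same coordinate at `c
(i + 1)` computes both multiplicities. -/
theorem IsBlowupSequence.mult_eq_succ (hT : IsBlowupSequence S s T) (hS : IsBranch S)
    (h : ExcThrough s j (i + 2)) (hji : j < i) : mult (T i) = mult (T (i + 1)) := by
  rw [← Nat.cast_inj (R := ℕ∞)]
  rcases excThrough_iff.1 h with h1 | h1
  · rw [(hT.mult_of_eq_infty hS (h1.2.2 i hji (by omega))).2.1,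
      (hT.mult_of_eq_infty hS (h1.2.2 (i + 1) (by omega) (by omega))).1]
  · have h2 := h1.2.2 i hji (by omega)
    have h3 := h1.2.2 (i + 1) (by omega) (by omega)
    rw [(hT.mult_of_ne_infty hS (h2 ▸ OnePoint.coe_ne_infty _ : s i ≠ OnePoint.infty)).2,
      (hT.mult_of_ne_infty hS (h3 ▸ OnePoint.coe_ne_infty _ : s (i + 1) ≠ OnePoint.infty)).1]

theorem natCast_lt_add {a : ℕ} {b : ℕ∞} (hb : b ≠ 0) : (a : ℕ∞) < a + b :=
  lt_of_lt_of_le (by exact_mod_cast a.lt_succ_self : (a : ℕ∞) < a + 1)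
    (add_le_add_right (Order.one_le_iff_ne_zero.2 hb) _)

/-- If `D i` passes through `c (i + 2)`, the Puiseux pair of `T i` is read off the
multiplicities. -/
theorem IsBlowupSequence.hasPuiseuxPair_iff (hT : IsBlowupSequence S s T) (hS : IsBranch S)
    (h : ExcThrough s i (i + 2)) (q : ℕ) :
    HasPuiseuxPair (T i) (mult (T i)) q ↔ q = mult (T i) + mult (T (i + 1)) := by
  obtain ⟨ha, h0⟩ := hT.analyticAt hS i
  have hpos := hT.mult_pos hS i
  have hpos' := hT.mult_pos hS (i + 1)
  -- The strict drop of the multiplicity yields both `p < q` and `p ∤ q`; it holds since `D i` still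
  -- meets the branch at `c (i + 2)`.
  suffices H : mult (T (i + 1)) < mult (T i) ∧ ∃ L : (ℂ × ℂ) ≃L[ℂ] (ℂ × ℂ),
      analyticOrderAt (fun t => (L (T i t)).1) 0 = mult (T i) ∧
      analyticOrderAt (fun t => (L (T i t)).2) 0 = (mult (T i) + mult (T (i + 1)) : ℕ) by
    obtain ⟨hlt, L, h1, h2⟩ := H
    have hdvd : ¬ mult (T i) ∣ mult (T i) + mult (T (i + 1)) := by
      rw [Nat.dvd_add_right dvd_rfl]
      exact Nat.not_dvd_of_pos_of_lt hpos' hlt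
    constructor
    · exact fun h => h.eq_of_order L ha h0 h1 h2 hdvd
    · rintro rfl
      exact hasPuiseuxPair_of_order L ha hpos.ne' h1 h2 (by omega) hdvd
  have hl := hT.2 i
  obtain ⟨ha2, h02⟩ := hT.analyticAt hS (i + 2)
  rw [excThrough_iff, isVertical_succ_iff (by omega), isHorizontal_succ_iff (by omega)] at h
  rcases h with ⟨h1, h2⟩ | ⟨h1, h2⟩
  · have h3 := (hT.mult_of_ne_infty hS h1.2.1).2
    obtain ⟨h4, h5, h6⟩ := hT.mult_of_eq_infty hS h2
    have hlt : mult (T (i + 1)) < mult (T i) := by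
      rw [← Nat.cast_lt (α := ℕ∞), h3, h6, ← h5, add_comm (fstOrder _)]
      exact natCast_lt_add (fstOrder_ne_zero ha2 h02)
    refine ⟨hlt, ?_⟩
    have h7 := h1.2.1
    cases hs : s i with
    | infty => exact absurd hs h7
    | coe c =>
      rw [hs] at hl
      -- The change `(x, y) ↦ (x, y - c x)` makes the tangent line horizontal.
      refine ⟨ContinuousLinearEquiv.skewProd (.refl ℂ ℂ) (.refl ℂ ℂ)
        (-(c • ContinuousLinearMap.id ℂ ℂ)), ?_, ?_⟩
      · rw [h3, ← hl.fstOrder_coe]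
        rfl
      · rw [Nat.cast_add, h3, h4, ← hl.sub_order_coe]
        simp [sub_eq_add_neg]
  · rw [h1.2.1] at hl
    have h3 := (hT.mult_of_eq_infty hS h1.2.1).2.1
    have h4 := hT.mult_of_ne_infty hS (h2 ▸ OnePoint.coe_ne_infty _ : s (i + 1) ≠ OnePoint.infty)
    have hl' := hT.2 (i + 1)
    rw [h2] at hl'
    have hlt : mult (T (i + 1)) < mult (T i) := by
      rw [← Nat.cast_lt (α := ℕ∞), h3, hl'.sndOrder_zero, ← h4.2]
      exact natCast_lt_add (sndOrder_ne_zero ha2 h02)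
    refine ⟨hlt, ContinuousLinearEquiv.prodComm ℂ ℂ ℂ, ?_, ?_⟩
    · rw [h3, ← hl.sndOrder_infty]
      rfl
    · rw [Nat.cast_add, h3, h4.1, add_comm, ← hl.fstOrder_infty]
      rfl

/-! ### The last centre -/

theorem IsNormalCrossing.eq_of_excThrough (h : IsNormalCrossing s T (N + 1))
    (hj : ExcThrough s j (N + 1)) : j = N :=
  (Set.ncard_le_one (finite_setOf_excThrough s _)).1 h.2.1 _ hj _ (excThrough_succ s N)

/-- The multiplicity at `c N` is the intersection number of `D N` with the next strict transform,
which is `1` by transversality. -/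
theorem IsNormalCrossing.mult_eq_one (h : IsNormalCrossing s T (N + 1))
    (hT : IsBlowupSequence S s T) (hS : IsBranch S) : mult (T N) = 1 := by
  obtain ⟨ha, h0⟩ := hT.analyticAt hS (N + 1)
  rw [← Nat.cast_inj (R := ℕ∞), Nat.cast_one]
  by_cases hs : s N = OnePoint.infty
  · have h1 := h.2.2 N _ (isExcAt_iff.2 (Or.inr ⟨isHorizontal_succ hs, .rfl⟩))
    rw [transverse_iff_of_horizontal deriv_horizontalAxis] at h1
    rw [(hT.mult_of_eq_infty hS hs).2.1, (sndOrder_eq_one_iff ha h0).2 h1]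
  · have h1 := h.2.2 N _ (isExcAt_iff.2 (Or.inl ⟨isVertical_succ hs, .rfl⟩))
    rw [transverse_iff_of_vertical deriv_verticalAxis] at h1
    rw [(hT.mult_of_ne_infty hS hs).2, (fstOrder_eq_one_iff ha h0).2 h1]

/-- The last centre of the minimal desingularization is the intersection of two exceptional
components. -/
theorem exists_excThrough_last (h : IsNormalCrossing s T (N + 1)) (hN : ¬ IsNormalCrossing s T N)
    (hT : IsBlowupSequence S s T) (hS : IsBranch S) : ∃ j, j + 1 < N ∧ ExcThrough s j N := by
  by_contra! hno
  have hj : ∀ j, ExcThrough s j N → j + 1 = N := by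
    intro j hj
    have := hj.lt
    by_contra hne
    exact hno j (by omega) hj
  obtain ⟨ha, h0⟩ := hT.analyticAt hS N
  have hsm : IsSmoothGerm (T N) :=
    isSmoothGerm_of_mult_eq_one ha h0 (hT.not_eventually_zero hS N) (h.mult_eq_one hT hS)
  refine hN ⟨hsm, (Set.ncard_le_one (finite_setOf_excThrough s _)).2 fun a ha b hb => ?_, ?_⟩
  · have h1 := hj a ha
    have h2 := hj b hb
    omega
  · intro j σ hσ
    have hlt := hσ.1
    have hl := hT.2 N
    -- Tangency to `D j` at `c N` would carry `D j` on to `c (N + 1)`, where only `D N` passes.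
    by_contra hnt
    rcases isExcAt_iff.1 hσ with ⟨h1, h2⟩ | ⟨h1, h2⟩
    · rw [transverse_iff_of_vertical (h2.deriv_eq.trans deriv_verticalAxis), not_not] at hnt
      refine hlt.ne (h.eq_of_excThrough (excThrough_iff.2 (Or.inl
        ((isVertical_succ_iff hlt).2 ⟨h1, ?_⟩))))
      cases hs : s N with
      | infty => rfl
      | coe c =>
        rw [hs] at hl
        rw [hl.deriv_coe] at hnt
        simp only at hnt
        exact absurd (by rw [hl.deriv_coe, hnt, zero_mul]; rfl) hsm.2.2
    · rw [transverse_iff_of_horizontal (h2.deriv_eq.trans deriv_horizontalAxis), not_not] at hnt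
      refine hlt.ne (h.eq_of_excThrough (excThrough_iff.2 (Or.inr
        ((isHorizontal_succ_iff hlt).2 ⟨h1, ?_⟩))))
      cases hs : s N with
      | infty =>
        rw [hs] at hl
        rw [hl.deriv_infty] at hnt
        simp only at hnt
        exact absurd (by rw [hl.deriv_infty, hnt]; rfl) hsm.2.2
      | coe c =>
        rw [hs] at hl
        have hd := hsm.2.2
        rw [hl.deriv_coe] at hnt hd
        rcases mul_eq_zero.1 hnt with h3 | h3
        · exact absurd (by rw [h3, zero_mul]; rfl) hd
        · rw [h3]

end PlaneBranch

namespace PlaneBranch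

/-! ### Combinatorics of the minimal desingularization -/

/-- The minimal desingularization, by `n + 1` blowing-ups, of a branch, together with a
direction. -/
structure IsResolution (S : ℂ → ℂ × ℂ) (s : ℕ → OnePoint ℂ) (T : ℕ → ℂ → ℂ × ℂ) (n : ℕ)
    {r : ℕ} (d : Fin r → ℂ → ℂ × ℂ) : Prop where
  branch : IsBranch S
  seq : IsBlowupSequence S s T
  minimal : IsMinimalDesingularization s T (n + 1)
  le_two : r ≤ 2
  smooth : ∀ k, IsSmoothGerm (d k)
  transverse : Pairwise fun k l => Transverse (d k) (d l)

/-- The last centre on the component `D i`. -/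
noncomputable def lastCentre (s : ℕ → OnePoint ℂ) (i : ℕ) : ℕ := sSup {k | ExcThrough s i k}

/-- The entries of the vector to which the proximity matrix is applied. -/
noncomputable def halfMult (s : ℕ → OnePoint ℂ) (T : ℕ → ℂ → ℂ × ℂ) {r : ℕ}
    (d : Fin r → ℂ → ℂ × ℂ) (i : ℕ) : ℤ :=
  ((mult (T i) : ℤ) - (branchCount s d i : ℤ)) / 2 + 1

/-- The defect of `halfMult` from half the multiplicity, doubled. -/
noncomputable def defect (s : ℕ → OnePoint ℂ) (T : ℕ → ℂ → ℂ × ℂ) {r : ℕ}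
    (d : Fin r → ℂ → ℂ × ℂ) (i : ℕ) : ℤ :=
  2 * halfMult s T d i - mult (T i)

namespace IsResolution

variable {S : ℂ → ℂ × ℂ} {s : ℕ → OnePoint ℂ} {T : ℕ → ℂ → ℂ × ℂ} {n r : ℕ}
  {d : Fin r → ℂ → ℂ × ℂ} {i j k : ℕ}

/-- The centres on `D i` have no gaps, and they stop at `c n` because only `D n` passes through `c
(n + 1)`. Boundedness makes the supremum defining `lastCentre` an actual maximum. -/
theorem excThrough_iff_of_lt (H : IsResolution S s T n d) (hi : i < n) :
    ExcThrough s i k ↔ i < k ∧ k ≤ lastCentre s i := by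
  have hn : ∀ k, ExcThrough s i k → k ≤ n := by
    intro k hk
    by_contra! hlt
    exact hi.ne (H.minimal.1.eq_of_excThrough (hk.mono (by omega) hlt))
  have hb : BddAbove {k | ExcThrough s i k} := ⟨n, hn⟩
  constructor
  · exact fun h => ⟨h.lt, le_csSup hb h⟩
  · rintro ⟨h1, h2⟩
    have : ExcThrough s i (lastCentre s i) := Nat.sSup_mem ⟨i + 1, excThrough_succ s i⟩ hb
    exact this.mono h1 h2

theorem lt_lastCentre (H : IsResolution S s T n d) (hi : i < n) : i < lastCentre s i :=
  ((H.excThrough_iff_of_lt hi).1 (excThrough_succ s i)).2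

theorem lastCentre_le (H : IsResolution S s T n d) (hi : i < n) : lastCentre s i ≤ n := by
  have h := (H.excThrough_iff_of_lt hi (k := lastCentre s i)).2 ⟨H.lt_lastCentre hi, le_rfl⟩
  by_contra! hlt
  exact hi.ne (H.minimal.1.eq_of_excThrough (h.mono (by omega) hlt))

theorem lastCentre_eq (H : IsResolution S s T n d) (hi : i < n) (h : ExcThrough s i j)
    (h' : ¬ ExcThrough s i (j + 1)) : lastCentre s i = j := by
  rw [H.excThrough_iff_of_lt hi] at h h'
  omega

theorem branchCount_zero (H : IsResolution S s T n d) : branchCount s d 0 = r := by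
  have h1 : {j | ExcThrough s j 0} = ∅ := by
    ext j; simpa using fun h : ExcThrough s j 0 => absurd h.lt (Nat.not_lt_zero j)
  have h2 : {k | ∃ σ, IsLift (composite s 0 0) (d k) σ} = Set.univ :=
    Set.eq_univ_of_forall fun k => (H.smooth k).liftsTo_zero
  rw [branchCount, h1, h2, Set.ncard_empty, Set.ncard_univ, Nat.card_fin, zero_add]

/-- Exactly two exceptional components pass through such a centre, and a smooth germ can reach only
centres lying on the newest component alone. -/
theorem branchCount_of_satellite (H : IsResolution S s T n d) (hj : ExcThrough s j i)
    (hji : j + 1 < i) : branchCount s d i = 2 := by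
  obtain ⟨i, rfl⟩ : ∃ k, i = k + 1 := ⟨i - 1, by omega⟩
  have h1 : {j | ExcThrough s j (i + 1)} = {i, j} := by
    ext l
    simp only [Set.mem_ofPred_eq, Set.mem_insert_iff, Set.mem_singleton_iff]
    constructor
    · intro hl
      have := hl.lt
      by_cases hli : l = i
      · exact Or.inl hli
      · exact Or.inr (hl.unique hj (by omega) (by omega))
    · rintro (rfl | rfl)
      exacts [excThrough_succ s _, hj]
  have h2 : {k | ∃ σ, IsLift (composite s 0 (i + 1)) (d k) σ} = ∅ := by
    refine Set.eq_empty_of_forall_notMem fun k hk => ?_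
    have := LiftsTo.eq_of_excThrough (H.smooth k) hk hj
    omega
  rw [branchCount, h1, h2, Set.ncard_empty, Set.ncard_pair (by omega)]

theorem branchCount_of_free (hfree : ∀ j, ExcThrough s j (i + 1) → j = i) :
    branchCount s d (i + 1) = 1 + {k | LiftsTo s (d k) (i + 1)}.ncard := by
  have h1 : {j | ExcThrough s j (i + 1)} = {i} := by
    ext l
    exact ⟨hfree l, fun h => h ▸ excThrough_succ s i⟩
  rw [branchCount, h1, Set.ncard_singleton]
  rfl

theorem ncard_liftsTo_le_one (H : IsResolution S s T n d) :
    {k | LiftsTo s (d k) (i + 1)}.ncard ≤ 1 := by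
  refine (Set.ncard_le_one (Set.toFinite _)).2 fun k hk l hl => ?_
  by_contra hne
  exact (H.transverse hne).not_liftsTo (by omega) hk hl

theorem branchCount_succ_eq (H : IsResolution S s T n d) (i : ℕ) :
    branchCount s d (i + 1) = 1 ∨ branchCount s d (i + 1) = 2 := by
  by_cases hfree : ∀ j, ExcThrough s j (i + 1) → j = i
  · rw [branchCount_of_free hfree]
    have := H.ncard_liftsTo_le_one (i := i)
    omega
  · push Not at hfree
    obtain ⟨j, hj, hne⟩ := hfree
    have := hj.lt
    exact Or.inr (H.branchCount_of_satellite hj (by omega))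

theorem branchCount_le_two (H : IsResolution S s T n d) (i : ℕ) : branchCount s d i ≤ 2 := by
  cases i with
  | zero => rw [H.branchCount_zero]; exact H.le_two
  | succ i => have := H.branchCount_succ_eq i; omega

theorem free_of_branchCount_eq_one (H : IsResolution S s T n d)
    (h : branchCount s d (i + 1) = 1) :
    (∀ j, ExcThrough s j (i + 1) → j = i) ∧ ∀ k, ¬ LiftsTo s (d k) (i + 1) := by
  have hfree : ∀ j, ExcThrough s j (i + 1) → j = i := by
    intro j hj
    by_contra hne
    have := hj.lt
    have := H.branchCount_of_satellite hj (by omega)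
    omega
  refine ⟨hfree, fun k hk => ?_⟩
  rw [branchCount_of_free hfree, Nat.add_eq_left, Set.ncard_eq_zero] at h
  exact Set.eq_empty_iff_forall_notMem.1 h k hk

theorem exists_of_branchCount_eq_two (h : branchCount s d (i + 1) = 2) :
    (∃ j < i, ExcThrough s j (i + 1)) ∨ ∃ k, LiftsTo s (d k) (i + 1) := by
  by_cases hfree : ∀ j, ExcThrough s j (i + 1) → j = i
  · rw [branchCount_of_free hfree] at h
    obtain ⟨k, hk⟩ := Set.nonempty_of_ncard_ne_zero
      (s := {k | LiftsTo s (d k) (i + 1)}) (by omega)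
    exact Or.inr ⟨k, hk⟩
  · push Not at hfree
    obtain ⟨j, hj, hne⟩ := hfree
    have := hj.lt
    exact Or.inl ⟨j, by omega, hj⟩

theorem mult_last (H : IsResolution S s T n d) : mult (T n) = 1 :=
  H.minimal.1.mult_eq_one H.seq H.branch

theorem branchCount_last (H : IsResolution S s T n d) : branchCount s d n = 2 := by
  have hn : ¬ IsNormalCrossing s T n := fun h => by
    have := H.minimal.2 h
    omega
  obtain ⟨j, hj, h⟩ := exists_excThrough_last H.minimal.1 hn H.seq H.branch
  exact H.branchCount_of_satellite h hj

theorem mult_eq_sum (H : IsResolution S s T n d) (hi : i < n) :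
    mult (T i) = ∑ k ∈ Finset.Ioc i (lastCentre s i), mult (T k) := by
  refine H.seq.mult_eq_sum H.branch ((H.excThrough_iff_of_lt hi).2 ⟨H.lt_lastCentre hi, le_rfl⟩)
    fun h => ?_
  rw [H.excThrough_iff_of_lt hi] at h
  omega

/-! ### The defects -/

theorem neg_one_le_defect (H : IsResolution S s T n d) (i : ℕ) : -1 ≤ defect s T d i := by
  have := H.branchCount_le_two i
  rw [defect, halfMult]
  omega

theorem defect_succ_le_one (H : IsResolution S s T n d) (i : ℕ) : defect s T d (i + 1) ≤ 1 := by
  have := H.branchCount_succ_eq i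
  rw [defect, halfMult]
  omega

theorem defect_eq_neg_one_iff (H : IsResolution S s T n d) (i : ℕ) :
    defect s T d i = -1 ↔ branchCount s d i = 2 ∧ Odd (mult (T i)) := by
  have := H.branchCount_le_two i
  rw [defect, halfMult, Nat.odd_iff]
  omega

theorem defect_succ_eq_one_iff (H : IsResolution S s T n d) (i : ℕ) :
    defect s T d (i + 1) = 1 ↔ branchCount s d (i + 1) = 1 ∧ Odd (mult (T (i + 1))) := by
  have := H.branchCount_succ_eq i
  rw [defect, halfMult, Nat.odd_iff]
  omega

theorem even_of_defect_eq_zero (H : IsResolution S s T n d) (h : defect s T d i = 0) :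
    Even (mult (T i)) := by
  have := H.branchCount_le_two i
  rw [defect, halfMult] at h
  rw [Nat.even_iff]
  omega

theorem defect_of_satellite (H : IsResolution S s T n d) (hi : i < n)
    (hk : k ∈ Finset.Ioc (i + 1) (lastCentre s i)) :
    defect s T d k ≤ 0 ∧ (defect s T d k = 0 ↔ Even (mult (T k))) := by
  rw [Finset.mem_Ioc] at hk
  have := H.branchCount_of_satellite ((H.excThrough_iff_of_lt hi).2 ⟨by omega, hk.2⟩) hk.1
  rw [defect, halfMult, this, Nat.even_iff]
  omega

theorem sum_satellite_nonpos (H : IsResolution S s T n d) (hi : i < n) :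
    ∑ k ∈ Finset.Ioc (i + 1) (lastCentre s i), defect s T d k ≤ 0 :=
  Finset.sum_nonpos fun _ hk => (H.defect_of_satellite hi hk).1

/-! ### The vector `(p_i)` -/

theorem proximityMatrix_apply (H : IsResolution S s T n d) (hi : i < n) (k : Fin (n + 1)) :
    proximityMatrix s (n + 1) ⟨i, by omega⟩ k =
      if (k : ℕ) = i then 1 else if (k : ℕ) ∈ Finset.Ioc i (lastCentre s i) then -1 else 0 := by
  simp only [proximityMatrix, Matrix.of_apply, Fin.ext_iff, Finset.mem_Ioc,
    H.excThrough_iff_of_lt hi, eq_comm]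

theorem pVector_of_lt (H : IsResolution S s T n d) (hi : i < n) :
    pVector s T d (n + 1) ⟨i, by omega⟩ =
      halfMult s T d i - ∑ k ∈ Finset.Ioc i (lastCentre s i), halfMult s T d k := by
  have hle := H.lastCentre_le hi
  have h1 : pVector s T d (n + 1) ⟨i, by omega⟩ = ∑ k ∈ Finset.range (n + 1),
      (if k = i then 1 else if k ∈ Finset.Ioc i (lastCentre s i) then -1 else 0) *
        halfMult s T d k := by
    rw [Finset.sum_range]
    change ∑ k, proximityMatrix s (n + 1) ⟨i, by omega⟩ k * halfMult s T d k = _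
    exact Finset.sum_congr rfl fun k _ => by rw [H.proximityMatrix_apply hi]
  have h2 : ∀ k, (if k = i then (1 : ℤ) else if k ∈ Finset.Ioc i (lastCentre s i) then -1 else 0) *
      halfMult s T d k = (if k = i then halfMult s T d k else 0) -
        (if k ∈ Finset.Ioc i (lastCentre s i) then halfMult s T d k else 0) := by
    intro k
    by_cases hk : k = i
    · simp [hk]
    · by_cases hk' : k ∈ Finset.Ioc i (lastCentre s i) <;> simp only [hk, hk', if_true, if_false] <;>
        ring
  have h3 : Finset.range (n + 1) ∩ Finset.Ioc i (lastCentre s i) =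
      Finset.Ioc i (lastCentre s i) := by
    ext k; simp; omega
  rw [h1, Finset.sum_congr rfl fun k _ => h2 k, Finset.sum_sub_distrib, Finset.sum_ite_eq',
    if_pos (by simp; omega), Finset.sum_ite_mem, h3]

/-- The proximity equality says that the row of the proximity matrix annihilates the multiplicities,
so only the rounding defects survive. -/
theorem two_mul_pVector (H : IsResolution S s T n d) (hi : i < n) :
    2 * pVector s T d (n + 1) ⟨i, by omega⟩ = defect s T d i - defect s T d (i + 1) -
      ∑ k ∈ Finset.Ioc (i + 1) (lastCentre s i), defect s T d k := by
  have h1 : Finset.Ioc i (lastCentre s i) = insert (i + 1) (Finset.Ioc (i + 1) (lastCentre s i)) := by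
    have := H.lt_lastCentre hi
    ext k; simp; omega
  have h2 : ∑ k ∈ Finset.Ioc i (lastCentre s i), defect s T d k =
      2 * ∑ k ∈ Finset.Ioc i (lastCentre s i), halfMult s T d k - mult (T i) := by
    rw [H.mult_eq_sum hi, Nat.cast_sum, Finset.mul_sum, ← Finset.sum_sub_distrib]
    rfl
  rw [sub_sub, ← Finset.sum_insert (by simp), ← h1, h2, H.pVector_of_lt hi, defect]
  ring

theorem pVector_last (H : IsResolution S s T n d) : pVector s T d (n + 1) (Fin.last n) = 0 := by
  have h : ∀ k : Fin (n + 1), k ≠ Fin.last n → proximityMatrix s (n + 1) (Fin.last n) k = 0 := by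
    intro k hk
    have h1 : ¬ ExcThrough s (Fin.last n) k := fun h => by
      have := h.lt
      simp at this
      omega
    rw [proximityMatrix, Matrix.of_apply, if_neg hk.symm, if_neg h1]
  rw [pVector, Matrix.mulVec, dotProduct, Finset.sum_eq_single (Fin.last n)
    (fun k _ hk => by rw [h k hk, zero_mul]) (by simp)]
  rw [Fin.val_last, H.mult_last, H.branchCount_last]
  simp [proximityMatrix]

theorem neg_one_le_pVector (H : IsResolution S s T n d) (hi : i < n) :
    -1 ≤ pVector s T d (n + 1) ⟨i, by omega⟩ := by
  have h1 := H.two_mul_pVector hi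
  have h2 := H.sum_satellite_nonpos hi
  have h3 := H.neg_one_le_defect i
  have h4 := H.defect_succ_le_one i
  omega

/-- The bounds on the three parts of `two_mul_pVector` add up to exactly `-2`, so each must be
attained. -/
theorem pVector_eq_neg_one_iff (H : IsResolution S s T n d) (hi : i < n) :
    pVector s T d (n + 1) ⟨i, by omega⟩ = -1 ↔ defect s T d i = -1 ∧ defect s T d (i + 1) = 1 ∧
      ∀ k ∈ Finset.Ioc (i + 1) (lastCentre s i), defect s T d k = 0 := by
  have h1 := H.two_mul_pVector hi
  have h2 := H.sum_satellite_nonpos hi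
  have h3 := H.neg_one_le_defect i
  have h4 := H.defect_succ_le_one i
  rw [← Finset.sum_eq_zero_iff_of_nonpos fun _ hk => (H.defect_of_satellite hi hk).1]
  omega

theorem defect_lastCentre_ne (H : IsResolution S s T n d) (hi : i < n)
    (h : pVector s T d (n + 1) ⟨i, by omega⟩ = -1) : defect s T d (lastCentre s i) ≠ -1 := by
  obtain ⟨-, h2, h3⟩ := (H.pVector_eq_neg_one_iff hi).1 h
  have hlt := H.lt_lastCentre hi
  by_cases he : lastCentre s i = i + 1
  · rw [he, h2]; norm_num
  · rw [h3 _ (Finset.mem_Ioc.2 ⟨by omega, le_rfl⟩)]; norm_num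

theorem rowNumber_of_lt (H : IsResolution S s T n d) (hi : i < n) :
    rowNumber s (n + 1) ⟨i, by omega⟩ = lastCentre s i - i + 1 := by
  have hle := H.lastCentre_le hi
  have : Fin.val '' {k | proximityMatrix s (n + 1) ⟨i, by omega⟩ k = -1} =
      (Finset.Ioc i (lastCentre s i) : Set ℕ) := by
    ext k
    simp only [Set.mem_image, Set.mem_ofPred_eq, H.proximityMatrix_apply hi, Finset.mem_coe]
    constructor
    · rintro ⟨k, hk, rfl⟩
      by_contra hk'
      rw [if_neg hk'] at hk
      split_ifs at hk
    · intro hk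
      have hk' := Finset.mem_Ioc.1 hk
      exact ⟨⟨k, by omega⟩, by rw [if_neg (by simp; omega), if_pos hk], rfl⟩
  rw [rowNumber, ← Set.ncard_image_of_injective _ Fin.val_injective, this, Set.ncard_coe_finset,
    Nat.card_Ioc]

theorem rowNumber_last : rowNumber s (n + 1) (Fin.last n) = 1 := by
  have : {k | proximityMatrix s (n + 1) (Fin.last n) k = -1} = ∅ := by
    refine Set.eq_empty_of_forall_notMem fun k hk => ?_
    have h1 : ¬ ExcThrough s (Fin.last n) k := fun h => by
      have := h.lt
      simp at this
      omega
    rw [Set.mem_ofPred_eq, proximityMatrix, Matrix.of_apply, if_neg h1] at hk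
    split_ifs at hk
  rw [rowNumber, this, Set.ncard_empty]

/-- With one centre on `D i`, `ν_i = ν_{i+1}` and the two parities agree. With two, `ν_i = ν_{i+1} +
ν_{i+2}`, and for odd `ν_i` the parity of `q = ν_i + ν_{i+1}` decides. With three or more, `ν_{i+1}
= ν_{i+2}` would be both odd and even. -/
theorem pVector_eq_neg_one_iff_rowNumber (H : IsResolution S s T n d) (hi : i < n) :
    pVector s T d (n + 1) ⟨i, by omega⟩ = -1 ↔
      (rowNumber s (n + 1) ⟨i, by omega⟩ = 2 ∧ branchCount s d i = 2 ∧
        branchCount s d (i + 1) = 1 ∧ Odd (mult (T i))) ∨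
      (rowNumber s (n + 1) ⟨i, by omega⟩ = 3 ∧ branchCount s d i = 2 ∧
        branchCount s d (i + 1) = 1 ∧ Odd (mult (T i)) ∧
        ∃ q, HasPuiseuxPair (T i) (mult (T i)) q ∧ Even q) := by
  have hlt := H.lt_lastCentre hi
  have hsum := H.mult_eq_sum hi
  rw [H.pVector_eq_neg_one_iff hi, H.rowNumber_of_lt hi, H.defect_eq_neg_one_iff,
    H.defect_succ_eq_one_iff]
  obtain h1 | h1 | h1 : lastCentre s i = i + 1 ∨ lastCentre s i = i + 2 ∨
    i + 3 ≤ lastCentre s i := by omega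
  · have h2 : Finset.Ioc i (i + 1) = {i + 1} := by ext; simp
    rw [h1, h2, Finset.sum_singleton] at hsum
    simp [h1, hsum]
    tauto
  · have h2 : Finset.Ioc i (i + 2) = {i + 1, i + 2} := by ext; simp; omega
    have h3 : Finset.Ioc (i + 1) (i + 2) = {i + 2} := by ext; simp
    have h4 := (H.defect_of_satellite hi (k := i + 2) (by simp [h1])).2
    have h5 := H.seq.hasPuiseuxPair_iff H.branch
      ((H.excThrough_iff_of_lt hi (k := i + 2)).2 ⟨by omega, h1.ge⟩)
    have h6 : (∃ q, HasPuiseuxPair (T i) (mult (T i)) q ∧ Even q) ↔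
        Even (mult (T i) + mult (T (i + 1))) := by simp only [h5, exists_eq_left]
    rw [h6]
    rw [h1, h2, Finset.sum_pair (by omega)] at hsum
    simp only [h1, h3, Finset.mem_singleton, forall_eq, h4, hsum,
      Nat.even_iff, Nat.odd_iff]
    omega
  · have h2 := H.seq.mult_eq_succ H.branch
      ((H.excThrough_iff_of_lt hi (k := i + 3)).2 ⟨by omega, h1⟩) (Nat.lt_succ_self i)
    have h3 := (H.defect_of_satellite hi (k := i + 2) (Finset.mem_Ioc.2 ⟨by omega, by omega⟩)).2
    constructor
    · rintro ⟨-, ⟨-, h4⟩, h5⟩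
      have := h3.1 (h5 (i + 2) (Finset.mem_Ioc.2 ⟨by omega, by omega⟩))
      rw [h2, ← Nat.not_even_iff_odd] at h4
      exact absurd this h4
    · rintro (⟨h, -⟩ | ⟨h, -⟩) <;> omega

/-! ### Connected components -/

/-- Of the two branches at `c (i + 1)`, one is `D i`. If `D i` goes on to `c (i + 2)`, the other
cannot: an earlier component ends here, and a branch of the direction is excluded by `hd`. -/
theorem exists_lastCentre_eq (H : IsResolution S s T n d) (hi : i + 1 < n)
    (h : branchCount s d (i + 1) = 2)
    (hd : ∀ k, LiftsTo s (d k) (i + 1) → LiftsTo s (d k) (i + 2)) :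
    ∃ l < i + 1, lastCentre s l = i + 1 := by
  by_cases hl : ExcThrough s i (i + 2)
  · rcases exists_of_branchCount_eq_two h with ⟨j, hj, hji⟩ | ⟨k, hk⟩
    · exact ⟨j, by omega, H.lastCentre_eq (by omega) hji fun hj' =>
        hj.ne (hj'.unique hl (by omega) (by omega))⟩
    · have := (hd k hk).eq_of_excThrough (H.smooth k) hl
      omega
  · exact ⟨i, by omega, H.lastCentre_eq (by omega) (excThrough_succ s i) hl⟩

/-- No connected component `I` of the dual graph, deprived of the last vertex and of the vertices
with `p_i = -1`, has only vertices with `p_i = 0` and not met by the direction. -/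
theorem false_of_component (H : IsResolution S s T n d) (I : ℕ → Prop)
    (hn : ∀ l, I l → l < n)
    (hp : ∀ l (hl : l < n), I l → pVector s T d (n + 1) ⟨l, by omega⟩ = 0)
    (hd : ∀ l, I l → ∀ k, LiftsTo s (d k) l → LiftsTo s (d k) (l + 1))
    (hdown : ∀ l (hl : l < n), pVector s T d (n + 1) ⟨l, by omega⟩ ≠ -1 →
      I (lastCentre s l) → I l)
    (hup : ∀ l, I l → ∀ hl : lastCentre s l < n,
      pVector s T d (n + 1) ⟨lastCentre s l, by omega⟩ ≠ -1 → I (lastCentre s l))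
    (hne : ∃ l, I l) : False := by
  classical
  obtain ⟨m, hm, hmin⟩ : ∃ m, I m ∧ ∀ l < m, ¬ I l :=
    ⟨Nat.find hne, Nat.find_spec hne, fun _ h => Nat.find_min hne h⟩
  -- Defect `-1` means two branches at `c m`. For `m = 0` the two transverse germs cannot both
  -- continue; otherwise some `D l` ends at `c m`, and `l` belongs to `I`, against minimality.
  have hmd : 0 ≤ defect s T d m := by
    by_contra! hlt
    have h1 := H.neg_one_le_defect m
    obtain ⟨h2, h3⟩ := (H.defect_eq_neg_one_iff m).1 (by omega)
    cases m with
    | zero =>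
      rw [H.branchCount_zero] at h2
      subst h2
      refine (H.transverse (by decide : (0 : Fin 2) ≠ 1)).not_liftsTo le_rfl
        (hd 0 hm 0 (H.smooth 0).liftsTo_zero) (hd 0 hm 1 (H.smooth 1).liftsTo_zero)
    | succ m =>
      have hmn := hn _ hm
      obtain ⟨l, hl, hlm⟩ := H.exists_lastCentre_eq hmn h2 (hd _ hm)
      refine hmin l hl (hdown l (by omega) (fun hpl => ?_) (by rwa [hlm]))
      refine H.defect_lastCentre_ne (by omega) hpl ?_
      rw [hlm]
      omega
  obtain ⟨a, ⟨ha, had⟩, hmax⟩ : ∃ a, (I a ∧ 0 ≤ defect s T d a) ∧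
      ∀ b, I b → 0 ≤ defect s T d b → b ≤ a := by
    refine ⟨Nat.findGreatest (fun a => I a ∧ 0 ≤ defect s T d a) n,
      Nat.findGreatest_spec (m := m) (P := fun a => I a ∧ 0 ≤ defect s T d a) (hn m hm).le ⟨hm, hmd⟩,
      fun b hb hb' => ?_⟩
    exact Nat.le_findGreatest (P := fun a => I a ∧ 0 ≤ defect s T d a) (hn b hb).le ⟨hb, hb'⟩
  have han := hn a ha
  have hlt := H.lt_lastCentre han
  -- The last centre on `D a` is `c n`, a removed vertex, or a vertex of `I` beyond `a`; the last
  -- case is settled by the maximality of `a`.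
  have hb : defect s T d (lastCentre s a) = -1 := by
    rcases (H.lastCentre_le han).eq_or_lt with h | h
    · rw [h, H.defect_eq_neg_one_iff, H.branchCount_last, H.mult_last]
      exact ⟨rfl, odd_one⟩
    · by_cases hpb : pVector s T d (n + 1) ⟨lastCentre s a, by omega⟩ = -1
      · exact ((H.pVector_eq_neg_one_iff h).1 hpb).1
      · have h1 := hup a ha h hpb
        have h2 := H.neg_one_le_defect (lastCentre s a)
        by_contra hne
        have := hmax _ h1 (by omega)
        omega
  have hpa := H.two_mul_pVector han
  rw [hp a han ha] at hpa
  have hle1 := H.defect_succ_le_one a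
  have hne1 : lastCentre s a ≠ a + 1 := by
    intro h
    rw [h, Finset.Ioc_self, Finset.sum_empty] at hpa
    rw [h] at hb
    omega
  have hsum : ∑ k ∈ Finset.Ioc (a + 1) (lastCentre s a), defect s T d k ≤ -1 := by
    have := Finset.single_le_sum (f := fun k => - defect s T d k)
      (fun k hk => neg_nonneg.2 (H.defect_of_satellite han hk).1)
      (Finset.mem_Ioc.2 ⟨by omega, le_rfl⟩ : lastCentre s a ∈ Finset.Ioc (a + 1) (lastCentre s a))
    rw [Finset.sum_neg_distrib, hb] at this
    omega
  -- In `0 = e_a - e_{a+1} - ∑` one has `e_a ≥ 0`, `e_{a+1} ≤ 1` and `∑ ≤ -1`, so these are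
  -- equalities.
  have hδ := ((H.defect_succ_eq_one_iff a).1 (by omega)).1
  have heven : Even (mult (T a)) := H.even_of_defect_eq_zero (by omega)
  obtain ⟨hfree, hdir⟩ := H.free_of_branchCount_eq_one hδ
  -- Descending induction: for `l < a` the centres on `D l` stop by `c a`, since `c (a + 1)` lies on
  -- `D a` alone. So `ν_l` is a sum of even numbers, which rules out `p_l = -1` and keeps `l` in
  -- `I`.
  have key : ∀ l ≤ a, I l ∧ Even (mult (T l)) := by
    intro l hl
    induction hk : a - l using Nat.strong_induction_on generalizing l with
    | _ k ih =>
      subst hk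
      rcases hl.eq_or_lt with rfl | hla
      · exact ⟨ha, heven⟩
      · have hln : l < n := by omega
        have h1 := H.lt_lastCentre hln
        have h2 : lastCentre s l ≤ a := by
          by_contra! h
          have := hfree l ((H.excThrough_iff_of_lt hln).2 ⟨by omega, h⟩)
          omega
        have h3 : Even (mult (T l)) := by
          rw [H.mult_eq_sum hln, even_iff_two_dvd]
          refine Finset.dvd_sum fun k hk => even_iff_two_dvd.1 ?_
          rw [Finset.mem_Ioc] at hk
          exact (ih (a - k) (by omega) k (by omega) rfl).2
        refine ⟨hdown l hln (fun h => ?_)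
          (ih (a - lastCentre s l) (by omega) _ h2 rfl).1, h3⟩
        have := ((H.defect_eq_neg_one_iff l).1 ((H.pVector_eq_neg_one_iff hln).1 h).1).2
        exact absurd h3 (Nat.not_even_iff_odd.2 this)
  have hlift : ∀ l ≤ a + 1, ∀ k, LiftsTo s (d k) l := by
    intro l hl k
    induction l with
    | zero => exact (H.smooth k).liftsTo_zero
    | succ l ih => exact hd l (key l (by omega)).1 k (ih (by omega))
  have hr : r = 0 := by
    by_contra hr
    exact hdir ⟨0, Nat.pos_of_ne_zero hr⟩ (hlift _ le_rfl _)
  -- With an empty direction and `ν_0` even, `e_0 = 2` exceeds what is subtracted from it, so `p_0 >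
  -- 0`.
  obtain ⟨h0, h0e⟩ := key 0 (Nat.zero_le a)
  have h0n := hn 0 h0
  have hp0 := H.two_mul_pVector h0n
  rw [hp 0 h0n h0] at hp0
  have h1 := H.sum_satellite_nonpos h0n
  have h2 := H.defect_succ_le_one 0
  have h3 : defect s T d 0 = 2 := by
    rw [Nat.even_iff] at h0e
    rw [defect, halfMult, H.branchCount_zero]
    omega
  omega

theorem dualGraph_adj (H : IsResolution S s T n d) (hi : i < n) :
    (dualGraph s (n + 1)).Adj ⟨i, by omega⟩
      ⟨lastCentre s i, Nat.lt_succ_of_le (H.lastCentre_le hi)⟩ := by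
  have h1 := H.lt_lastCentre hi
  have h2 := H.lastCentre_le hi
  refine ⟨by simp [h1.ne], ?_⟩
  refine (component_inter_nonempty_iff h1 (by omega)).2
    ⟨(H.excThrough_iff_of_lt hi).2 ⟨h1, le_rfl⟩, fun _ h => ?_⟩
  rw [H.excThrough_iff_of_lt hi] at h
  omega

theorem not_both_eq_neg_one (H : IsResolution S s T n d) (hij : i < j) (hj : j < n + 1)
    (h : (component s (n + 1) i ∩ component s (n + 1) j).Nonempty)
    (hpi : pVector s T d (n + 1) ⟨i, by omega⟩ = -1)
    (hpj : pVector s T d (n + 1) ⟨j, hj⟩ = -1) : False := by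
  obtain ⟨h1, h2⟩ := (component_inter_nonempty_iff hij hj).1 h
  have hi : i < n := by omega
  by_cases hjn : j = n
  · subst hjn
    have := H.pVector_last
    rw [show Fin.last j = ⟨j, hj⟩ from rfl, hpj] at this
    omega
  · have hl := H.lastCentre_eq hi h1 (h2 (by omega))
    exact H.defect_lastCentre_ne hi hpi
      (hl ▸ ((H.pVector_eq_neg_one_iff (by omega)).1 hpj).1)

end IsResolution

end PlaneBranch

theorem mainTheorem9
    -- an irreducible germ of curve, and its infinitely near points
    (S : ℂ → ℂ × ℂ) (hS : IsBranch S)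
    (s : ℕ → OnePoint ℂ) (T : ℕ → ℂ → ℂ × ℂ) (hT : IsBlowupSequence S s T)
    -- its minimal desingularization
    (N : ℕ) (hN : IsMinimalDesingularization s T N)
    -- a direction: at most two smooth germs, transverse if there are two
    (r : ℕ) (hr : r ≤ 2) (d : Fin r → ℂ → ℂ × ℂ) (hd : ∀ k, IsSmoothGerm (d k))
    (hd' : Pairwise fun k l => Transverse (d k) (d l)) :
    (∀ i : Fin N, 1 ≤ (i : ℕ) → branchCount s d i = 1 ∨ branchCount s d i = 2) ∧
    (∀ i : Fin N, -1 ≤ pVector s T d N i ∧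
      (pVector s T d N i = -1 ↔
        (rowNumber s N i = 2 ∧ branchCount s d i = 2 ∧ branchCount s d (i + 1) = 1 ∧
          Odd (mult (T i))) ∨
        (rowNumber s N i = 3 ∧ branchCount s d i = 2 ∧ branchCount s d (i + 1) = 1 ∧
          Odd (mult (T i)) ∧ ∃ q, HasPuiseuxPair (T i) (mult (T i)) q ∧ Even q))) ∧
    (∀ i j : Fin N, i ≠ j → (component s N i ∩ component s N j).Nonempty →
      ¬ (pVector s T d N i = -1 ∧ pVector s T d N j = -1)) ∧
    (∀ C : ((dualGraph s N).induce
        {i : Fin N | (i : ℕ) + 1 ≠ N ∧ pVector s T d N i ≠ -1}).ConnectedComponent,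
      ∃ j ∈ C.supp, 0 < pVector s T d N j ∨
        ∃ k, (strictPoints s N 0 (d k) ∩ component s N j).Nonempty) := by
  cases N with
  | zero =>
    -- For `N = 0` nothing is blown up and the divisor has no components.
    refine ⟨fun i => i.elim0, fun i => i.elim0, fun i => i.elim0, fun C => ?_⟩
    obtain ⟨v, -⟩ := C.nonempty_supp
    exact v.1.elim0
  | succ n =>
  have H : IsResolution S s T n d := ⟨hS, hT, hN, hr, hd, hd'⟩
  refine ⟨?_, ?_, ?_, ?_⟩
  · rintro ⟨_ | i, hi⟩ h
    · simp at h
    · exact H.branchCount_succ_eq i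
  · rintro ⟨i, hi⟩
    rcases (Nat.lt_succ_iff.1 hi).eq_or_lt with rfl | hin
    · have h1 := H.pVector_last
      have h2 := IsResolution.rowNumber_last (s := s) (n := i)
      rw [show Fin.last i = ⟨i, hi⟩ from rfl] at h1 h2
      rw [h1, h2]
      norm_num
    · exact ⟨H.neg_one_le_pVector hin, H.pVector_eq_neg_one_iff_rowNumber hin⟩
  · rintro ⟨i, hi⟩ ⟨j, hj⟩ hne h ⟨h1, h2⟩
    rcases lt_trichotomy i j with hij | rfl | hij
    · exact H.not_both_eq_neg_one hij hj h h1 h2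
    · exact hne rfl
    · exact H.not_both_eq_neg_one hij hi (by rwa [Set.inter_comm]) h2 h1
  · intro C
    by_contra! hC
    obtain ⟨v, hv⟩ := C.nonempty_supp
    have hpn : ∀ i : Fin (n + 1), -1 ≤ pVector s T d (n + 1) i := by
      rintro ⟨i, hi⟩
      rcases (Nat.lt_succ_iff.1 hi).eq_or_lt with rfl | hin
      · have h1 := H.pVector_last
        rw [show Fin.last i = ⟨i, hi⟩ from rfl] at h1
        omega
      · exact H.neg_one_le_pVector hin
    have hadj : ∀ v w : {i : Fin (n + 1) | (i : ℕ) + 1 ≠ n + 1 ∧ pVector s T d (n + 1) i ≠ -1},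
        (dualGraph s (n + 1)).Adj v w → v ∈ C.supp → w ∈ C.supp := fun v w h hv =>
      C.mem_supp_of_adj_mem_supp hv h
    -- Only the edges joining `l` to `lastCentre s l` are needed to propagate membership in the
    -- connected component.
    refine H.false_of_component (fun l => ∃ v ∈ C.supp, (v.1 : ℕ) = l) ?_ ?_ ?_ ?_ ?_ ⟨_, v, hv, rfl⟩
    · rintro l ⟨v, -, rfl⟩
      have h1 := v.1.2
      have h2 := v.2.1
      omega
    · rintro l hl ⟨v, hv, rfl⟩
      have h1 := (hC v hv).1
      have h2 := v.2.2
      have h3 := hpn v.1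
      change pVector s T d (n + 1) v.1 = 0
      omega
    · rintro l ⟨v, hv, rfl⟩ k hk
      by_contra hk'
      exact (hk.strictPoints_inter_component (hd k) v.1.2 hk').ne_empty ((hC v hv).2 k)
    · rintro l hl hpl ⟨v, hv, hvl⟩
      refine ⟨⟨⟨l, by omega⟩, by simp; omega, hpl⟩, hadj v _ ?_ hv, rfl⟩
      have := (H.dualGraph_adj hl).symm
      rwa [show (⟨lastCentre s l, _⟩ : Fin (n + 1)) = v.1 from Fin.ext hvl.symm] at this
    · rintro l ⟨v, hv, rfl⟩ hl hpl
      have h1 := v.1.2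
      have h2 := v.2.1
      have h3 : (v.1 : ℕ) < n := by omega
      exact ⟨⟨⟨_, by omega⟩, by simp; omega, hpl⟩, hadj v _ (H.dualGraph_adj h3) hv, rfl⟩
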